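/- **Setting.** Let $V=\{x_1,\dots,x_n\}$ be a set of Boolean variables. A clause is a disjunction of three literals over three distinct variables of $V$ (so there are $M=8\binom n3$ clauses), and a 3CNF formula is a set of clauses. A clause contains a variable $x$ if it contains the literal $x$ or $\bar x$. For $p\in[0,1]$, ${\cal P}^{\rm sat}_{n,p}$ is the distribution of the random formula $F^*$ obtained as follows: permute all $M$ clauses uniformly at random and toss, independently, for each clause a coin with success probability $p$; starting from the empty formula, scan the clauses in the order of the permutation and include each clause whose coin toss succeeded if its addition leaves the formula satisfiable. **Definitions.** Let $F$ be a 3CNF formula on $V$, let $\psi$ be an assignment, and let $Z\subseteq V$. Write $F[Z]$ for the set of clauses of $F$ all of whose three variables belong to $Z$. - A variable $x$ *supports* a clause $C$ in which it appears w.r.t. $\psi$ if $x$ is the only variable whose literal in $C$ evaluates to true under $\psi$. - $Z$ is *$t$-expanding* in $F$ w.r.t. $\psi$ if every $x\in Z$ supports at least $t$ clauses of $F[Z]$ w.r.t. $\psi$. - $Z$ is *$r$-self-contained* in $F$ if every $x\in Z$ appears in at most $r$ clauses of $F\setminus F[Z]$. - $Z$ is a *$t$-core* of $F$ w.r.t.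 $\psi$ if it is $t$-expanding in $F$ w.r.t. $\psi$ and $(t/3)$-self-contained in $F$. - $Z$ is *frozen* in $F$ if each variable of $Z$ takes the same value in all satisfying assignments of $F$. - $F$ is *$\rho$-proportional* if there is no nonempty set $U\subseteq V$ with $|U|\le n/10^6$ such that at least $\rho|U|$ clauses of $F$ each contain at least two variables of $U$. - For $p=p(n)$, an event holds *whp* if its probability is $1-o(m^{-1/2})$ as $n\to\infty$, where $m=Mp$. **Proposition.** There are constants $d,c>0$ and positive integers $t=t(n,p)$, depending only on $n$ and $p$, such that the following holds for every $p=p(n)\in[0,1]$ with $n^2p\ge d$ for all sufficiently large $n$. Let $F^*$ be distributed according to ${\cal P}^{\rm sat}_{n,p}$. Then whp there exist a satisfying assignment $\psi$ of $F^*$ and a $t$-core ${\cal H}$ of $F^*$ w.r.t. $\psi$ such that 1. $|{\cal H}|\ge(1-e^{-c\,n^2p})\,n$, 2. ${\cal H}$ is frozen in $F^*$, 3. $F^*$ is $t/10$-proportional. -/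

import Mathlib

namespace RandomSat

/-- A 3-clause over the variables `Fin n`: a set of three literals with distinct underlying
variables. The literal `(x, true)` is `x`, the literal `(x, false)` is the negation of `x`.
There are `8 * n.choose 3` of them. -/
abbrev Clause (n : ℕ) : Type :=
  {C : Finset (Fin n × Bool) // C.card = 3 ∧ (C.image Prod.fst).card = 3}

/-- A 3CNF formula on `n` variables, as a set of clauses. -/
abbrev Formula (n : ℕ) : Type := Finset (Clause n)

abbrev Assignment (n : ℕ) : Type := Fin n → Bool

variable {n : ℕ}

/-- The variables that appear (negated or not) in a clause. -/
def vars (C : Clause n) : Finset (Fin n) := C.1.image Prod.fst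

/-- The literal `l` evaluates to true under `ψ`. -/
def LitTrue (ψ : Assignment n) (l : Fin n × Bool) : Prop := ψ l.1 = l.2

def Satisfies (ψ : Assignment n) (F : Formula n) : Prop :=
  ∀ C ∈ F, ∃ l ∈ C.1, LitTrue ψ l

def Satisfiable (F : Formula n) : Prop := ∃ ψ : Assignment n, Satisfies ψ F

/-- `x` is the only variable whose literal evaluates to true in `C` under `ψ`. -/
def Supports (ψ : Assignment n) (x : Fin n) (C : Clause n) : Prop :=
  (∃ l ∈ C.1, l.1 = x ∧ LitTrue ψ l) ∧ ∀ l ∈ C.1, LitTrue ψ l → l.1 = x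

/-- `F[Z]`: the clauses of `F` all of whose variables lie in `Z`. -/
def induced (F : Formula n) (Z : Finset (Fin n)) : Formula n :=
  F.filter fun C => vars C ⊆ Z

open Classical in
/-- `Z` is `t`-expanding in `F` with respect to `ψ`. -/
def IsExpanding (F : Formula n) (ψ : Assignment n) (t : ℝ) (Z : Finset (Fin n)) : Prop :=
  ∀ x ∈ Z, t ≤ (((induced F Z).filter fun C => Supports ψ x C).card : ℝ)

/-- `Z` is `r`-self-contained in `F`. -/
def IsSelfContained (F : Formula n) (r : ℝ) (Z : Finset (Fin n)) : Prop :=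
  ∀ x ∈ Z, (((F \ induced F Z).filter fun C => x ∈ vars C).card : ℝ) ≤ r

/-- `H` is a `t`-core of `F` with respect to `ψ`. -/
def IsCore (F : Formula n) (ψ : Assignment n) (t : ℝ) (H : Finset (Fin n)) : Prop :=
  IsExpanding F ψ t H ∧ IsSelfContained F (t / 3) H

/-- Every variable of `H` takes the same value in all satisfying assignments of `F`. -/
def IsFrozen (F : Formula n) (H : Finset (Fin n)) : Prop :=
  ∀ x ∈ H, ∀ ψ₁ ψ₂ : Assignment n, Satisfies ψ₁ F → Satisfies ψ₂ F → ψ₁ x = ψ₂ x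

/-- `F` is `ρ`-proportional: no nonempty set `U` of at most `n / 10 ^ 6` variables is such that at
least `ρ * |U|` clauses of `F` contain at least two variables of `U`. -/
def IsProportional (F : Formula n) (ρ : ℝ) : Prop :=
  ¬ ∃ U : Finset (Fin n), U.Nonempty ∧ (U.card : ℝ) ≤ (n : ℝ) / 10 ^ 6 ∧
    ρ * (U.card : ℝ) ≤ ((F.filter fun C => 2 ≤ (vars C ∩ U).card).card : ℝ)

/-- An ordering of all clauses. -/
abbrev ClauseOrder (n : ℕ) : Type := Fin (Fintype.card (Clause n)) ≃ Clause n

open Classical in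
/-- One step of the process: the clause `C` is added to the current formula `F` if its coin toss
succeeded (`C ∈ S`) and its addition leaves the formula satisfiable. -/
noncomputable def step (S : Finset (Clause n)) (F : Formula n) (C : Clause n) : Formula n :=
  if C ∈ S ∧ Satisfiable (insert C F) then insert C F else F

/-- The formula produced by scanning all clauses in the order `σ`, where `S` is the set of clauses
whose coin toss succeeded. -/
noncomputable def process (σ : ClauseOrder n) (S : Finset (Clause n)) : Formula n :=
  (List.ofFn σ).foldl (step S) ∅

/-- The probability that the clauses with a successful coin toss are exactly those of `S`, when
each clause has an independent coin with success probability `p`. -/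
def coinProb (p : ℝ) (S : Finset (Clause n)) : ℝ :=
  p ^ S.card * (1 - p) ^ (Fintype.card (Clause n) - S.card)

open Classical in
/-- The probability of the property `A` under `P^sat_{n,p}`: the order of the clauses is uniformly
random and, independently, each clause has an independent coin of bias `p`. -/
noncomputable def probSat (n : ℕ) (p : ℝ) (A : Formula n → Prop) : ℝ :=
  (∑ σ : ClauseOrder n, ∑ S : Finset (Clause n),
    if A (process σ S) then coinProb p S else 0) / (Fintype.card (ClauseOrder n) : ℝ)

/-- `F` has a satisfying assignment `ψ` and a frozen `t`-core with respect to `ψ` that has at least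
`s` variables, and `F` is `t/10`-proportional. -/
def HasLargeFrozenCore (F : Formula n) (t s : ℝ) : Prop :=
  ∃ (ψ : Assignment n) (H : Finset (Fin n)),
    Satisfies ψ F ∧ IsCore F ψ t H ∧ s ≤ (H.card : ℝ) ∧ IsFrozen F H ∧ IsProportional F (t / 10)

/-- A sequence of properties holds with high probability for `P^sat_{n,p}`, `p = p(n)`: it fails with
probability `o(m^{-1/2})`, where `m = 8 * n.choose 3 * p` is the expected number of successful
coin tosses. -/
def Whp (p : ℕ → ℝ) (A : (n : ℕ) → Formula n → Prop) : Prop :=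
  (fun n : ℕ => probSat n (p n) fun F => ¬ A n F) =o[Filter.atTop]
    fun n : ℕ => (8 * (n.choose 3 : ℝ) * p n) ^ (-(1 / 2) : ℝ)

end RandomSat

namespace RandomSat

variable {n : ℕ}

/-! Fix the order `σ`; the bound is proved for each order separately, only the coins `S` being
random. If `ψ` satisfies the output, then the output is exactly the planted formula `S ∩ satClauses
ψ` (`process_eq_inter`), and survival of `ψ` is monotone: helped by coins of clauses that `ψ`
satisfies, hurt by the others (`satisfies_process_of_le`). Harris' inequality therefore compares the
process with the planted model.

First, the reciprocal of the number of planted solutions is also increasing. Summing over `ψ` the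
probability-weighted reciprocals gives exactly 1, so the expected number of solutions of the output
is at most the planted bound `(1 + exp (-P/3)) ^ n`, with `P = p * (n-1).choose 2`
(`sum_expect_satInd_le`). Second, having low support is a decreasing event, so a union bound over
`ψ` costs only this number of solutions and not `2 ^ n` (`expect_lowSupport_le`).

Two further properties need no comparison: proportionality passes from `S` to subformulas, and a
first moment over all pairs shows that solutions of one planted formula differ in at most `n / 10 ^
6` variables.

The rest is deterministic (`hasLargeFrozenCore_of`). Removing the low-support variables and closing
up costs few variables, by proportionality, and leaves a core. Proportionality also forces nearby
solutions to agree on it. Each of the three failure probabilities is at most `1 / n ^ 2`, which is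
`o(m ^ (-1/2))` because `m = O(n ^ 3)`. -/

open Classical in
/-- The clauses satisfied by `ψ`. -/
noncomputable def satClauses (ψ : Assignment n) : Formula n :=
  Finset.univ.filter fun C => ∃ l ∈ C.1, LitTrue ψ l

lemma mem_satClauses {ψ : Assignment n} {C : Clause n} :
    C ∈ satClauses ψ ↔ ∃ l ∈ C.1, LitTrue ψ l := by
  simp [satClauses]

lemma satisfies_iff_subset {ψ : Assignment n} {F : Formula n} :
    Satisfies ψ F ↔ F ⊆ satClauses ψ := by
  simp only [Satisfies, Finset.subset_iff, mem_satClauses]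

lemma Satisfies.mono {ψ : Assignment n} {F G : Formula n} (h : Satisfies ψ G) (hFG : F ⊆ G) :
    Satisfies ψ F := fun C hC => h C (hFG hC)

lemma Satisfiable.mono {F G : Formula n} (h : Satisfiable G) (hFG : F ⊆ G) : Satisfiable F :=
  h.imp fun _ hψ => hψ.mono hFG

lemma satisfies_insert {ψ : Assignment n} {F : Formula n} {C : Clause n} :
    Satisfies ψ (insert C F) ↔ C ∈ satClauses ψ ∧ Satisfies ψ F := by
  simp only [satisfies_iff_subset, Finset.insert_subset_iff]

/-! ### The process -/

lemma subset_step (S F : Formula n) (C : Clause n) : F ⊆ step S F C := by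
  unfold step
  split_ifs
  · exact Finset.subset_insert _ _
  · exact subset_rfl

lemma subset_foldl_step (S : Formula n) (L : List (Clause n)) (F : Formula n) :
    F ⊆ L.foldl (step S) F := by
  induction L generalizing F with
  | nil => exact subset_rfl
  | cons C L ih => exact (subset_step S F C).trans (ih _)

lemma foldl_step_subset (S : Formula n) (L : List (Clause n)) (F : Formula n) :
    L.foldl (step S) F ⊆ F ∪ S := by
  induction L generalizing F with
  | nil => exact Finset.subset_union_left
  | cons C L ih =>
    refine (ih _).trans (Finset.union_subset ?_ Finset.subset_union_right)
    unfold step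
    split_ifs with h
    · exact Finset.insert_subset (Finset.mem_union_right _ h.1) Finset.subset_union_left
    · exact Finset.subset_union_left

lemma satisfiable_foldl_step (S : Formula n) (L : List (Clause n)) (F : Formula n)
    (hF : Satisfiable F) : Satisfiable (L.foldl (step S) F) := by
  induction L generalizing F with
  | nil => exact hF
  | cons C L ih =>
    refine ih _ ?_
    unfold step
    split_ifs with h
    · exact h.2
    · exact hF

/-- When `C` is scanned, `ψ` satisfies the current formula, a subset of the output; so `ψ` itself
witnesses that `C` may be added. -/
lemma mem_foldl_step {ψ : Assignment n} {S : Formula n} {L : List (Clause n)} {F : Formula n}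
    {C : Clause n} (hC : C ∈ L) (hS : C ∈ S) (hψ : C ∈ satClauses ψ)
    (hsat : Satisfies ψ (L.foldl (step S) F)) : C ∈ L.foldl (step S) F := by
  induction L generalizing F with
  | nil => simp at hC
  | cons D L ih =>
    rcases List.mem_cons.1 hC with rfl | hC
    · refine subset_foldl_step S L _ ?_
      have hF : Satisfies ψ F := hsat.mono (subset_foldl_step S (C :: L) F)
      have : Satisfiable (insert C F) := ⟨ψ, satisfies_insert.2 ⟨hψ, hF⟩⟩
      simp [step, hS, this]
    · exact ih hC hsat

/-- Run both processes in parallel, keeping `F ⊆ F'` and `F'` satisfied by `ψ`. A clause true under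
`ψ` is always admissible in the second run. A clause false under `ψ` was not added in the first run;
its coin in the second run succeeds only if it did in the first, and the larger formula `F'` still
rejects it. -/
lemma satisfies_foldl_step_of_le {ψ : Assignment n} {S S' : Formula n}
    (h₁ : S ∩ satClauses ψ ⊆ S') (h₂ : S' \ satClauses ψ ⊆ S) (L : List (Clause n))
    {F F' : Formula n} (hFF' : F ⊆ F') (hF' : Satisfies ψ F')
    (h : Satisfies ψ (L.foldl (step S) F)) : Satisfies ψ (L.foldl (step S') F') := by
  induction L generalizing F F' with
  | nil => exact hF'
  | cons C L ih =>
    have hF : Satisfies ψ (step S F C) := h.mono (subset_foldl_step S L _)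
    by_cases hC : C ∈ satClauses ψ
    · have hins : Satisfies ψ (insert C F') := satisfies_insert.2 ⟨hC, hF'⟩
      refine ih ?_ ?_ h
      · unfold step
        split_ifs with h3 h4 h4
        · exact Finset.insert_subset_insert _ hFF'
        · exact absurd ⟨h₁ (Finset.mem_inter.2 ⟨h3.1, hC⟩), ψ, hins⟩ h4
        · exact hFF'.trans (Finset.subset_insert _ _)
        · exact hFF'
      · unfold step
        split_ifs
        · exact hins
        · exact hF'
    · have h3 : ¬ (C ∈ S ∧ Satisfiable (insert C F)) := by
        intro h3
        simp only [step, h3, and_self, if_true] at hF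
        exact hC (satisfies_insert.1 hF).1
      have h4 : ¬ (C ∈ S' ∧ Satisfiable (insert C F')) := fun h4 =>
        h3 ⟨h₂ (Finset.mem_sdiff.2 ⟨h4.1, hC⟩), h4.2.mono (Finset.insert_subset_insert _ hFF')⟩
      have e3 : step S F C = F := by simp only [step, h3, if_false]
      have e4 : step S' F' C = F' := by simp only [step, h4, if_false]
      simp only [List.foldl_cons, e3, e4] at h ⊢
      exact ih hFF' hF' h

lemma satisfies_empty (ψ : Assignment n) : Satisfies ψ (∅ : Formula n) :=
  fun C hC => by simp at hC

lemma process_subset (σ : ClauseOrder n) (S : Formula n) : process σ S ⊆ S := by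
  simpa [process] using foldl_step_subset S (List.ofFn σ) ∅

lemma satisfiable_process (σ : ClauseOrder n) (S : Formula n) : Satisfiable (process σ S) :=
  satisfiable_foldl_step _ _ _ ⟨fun _ => true, satisfies_empty _⟩

lemma satisfies_process_of_le {ψ : Assignment n} {σ : ClauseOrder n} {S S' : Formula n}
    (h₁ : S ∩ satClauses ψ ⊆ S') (h₂ : S' \ satClauses ψ ⊆ S)
    (h : Satisfies ψ (process σ S)) : Satisfies ψ (process σ S') :=
  satisfies_foldl_step_of_le h₁ h₂ _ subset_rfl (satisfies_empty _) h

lemma process_eq_inter {ψ : Assignment n} {σ : ClauseOrder n} {S : Formula n}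
    (h : Satisfies ψ (process σ S)) : process σ S = S ∩ satClauses ψ := by
  refine Finset.Subset.antisymm
    (Finset.subset_inter (process_subset σ S) (satisfies_iff_subset.1 h)) fun C hC => ?_
  obtain ⟨hS, hψ⟩ := Finset.mem_inter.1 hC
  exact mem_foldl_step (by simpa [List.mem_ofFn] using σ.surjective C) hS hψ h

/-! ### Cores -/

lemma card_vars (C : Clause n) : (vars C).card = 3 := C.2.2

lemma IsProportional.mono {F G : Formula n} {ρ : ℝ} (h : IsProportional G ρ) (hFG : F ⊆ G) :
    IsProportional F ρ := by
  rintro ⟨U, hU, hUn, hUF⟩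
  refine h ⟨U, hU, hUn, hUF.trans ?_⟩
  exact_mod_cast Finset.card_le_card (Finset.filter_subset_filter _ hFG)

lemma Supports.mem_vars {ψ : Assignment n} {x : Fin n} {C : Clause n} (h : Supports ψ x C) :
    x ∈ vars C := by
  obtain ⟨⟨l, hl, rfl, -⟩, -⟩ := h
  exact Finset.mem_image_of_mem _ hl

lemma Supports.eq {ψ : Assignment n} {x y : Fin n} {C : Clause n} (hx : Supports ψ x C)
    (hy : Supports ψ y C) : x = y := by
  obtain ⟨⟨l, hl, rfl, hlt⟩, -⟩ := hx
  exact hy.2 l hl hlt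

lemma Supports.mem_satClauses {ψ : Assignment n} {x : Fin n} {C : Clause n}
    (h : Supports ψ x C) : C ∈ satClauses ψ := by
  obtain ⟨⟨l, hl, -, hlt⟩, -⟩ := h
  exact RandomSat.mem_satClauses.2 ⟨l, hl, hlt⟩

/-! ### Large cores from few variables of low support -/

open Classical in
/-- The variables that support fewer than `r` clauses of `F`. -/
noncomputable def lowSupport (F : Formula n) (ψ : Assignment n) (r : ℝ) : Finset (Fin n) :=
  Finset.univ.filter fun x => ((F.filter fun C => Supports ψ x C).card : ℝ) < r

/-- The number of incidences of `U` with the clauses of `F`, the first one of each clause not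
being counted. -/
def excess (F : Formula n) (U : Finset (Fin n)) : ℕ := ∑ C ∈ F, ((vars C ∩ U).card - 1)

lemma excess_le (F : Formula n) (U : Finset (Fin n)) :
    excess F U ≤ 2 * (F.filter fun C => 2 ≤ (vars C ∩ U).card).card := by
  rw [excess, Finset.card_filter, Finset.mul_sum]
  refine Finset.sum_le_sum fun C _ => ?_
  have : (vars C ∩ U).card ≤ 3 := (Finset.card_le_card Finset.inter_subset_left).trans
    (card_vars C).le
  split_ifs <;> omega

/-- A clause through `x` that already meets `U` gains one. With truncated subtraction, a clause that
meets `U` for the first time still contributes 0. -/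
lemma excess_insert (F : Formula n) {U : Finset (Fin n)} {x : Fin n} (hx : x ∉ U) :
    excess F U + (F.filter fun C => x ∈ vars C ∧ (vars C ∩ U).Nonempty).card
      ≤ excess F (insert x U) := by
  rw [excess, excess, Finset.card_filter, ← Finset.sum_add_distrib]
  refine Finset.sum_le_sum fun C _ => ?_
  have hle : (vars C ∩ U).card ≤ (vars C ∩ insert x U).card :=
    Finset.card_le_card (Finset.inter_subset_inter_left (Finset.subset_insert _ _))
  split_ifs with h
  · have h1 : vars C ∩ insert x U = insert x (vars C ∩ U) := by
      rw [Finset.inter_insert_of_mem h.1]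
    have h2 : x ∉ vars C ∩ U := fun h => hx (Finset.mem_inter.1 h).2
    rw [h1, Finset.card_insert_of_notMem h2]
    have := h.2.card_pos
    omega
  · omega

lemma mem_sdiff_induced_compl {F : Formula n} {U : Finset (Fin n)} {C : Clause n} :
    C ∈ F \ induced F Uᶜ ↔ C ∈ F ∧ (vars C ∩ U).Nonempty := by
  rw [Finset.mem_sdiff, induced, Finset.mem_filter, not_and]
  refine and_congr_right fun h => ?_
  rw [imp_iff_right h, ← Finset.not_disjoint_iff_nonempty_inter,
    Finset.subset_compl_iff_disjoint_right]

/-- A proportional formula in which few variables have low support has a large core. -/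
theorem exists_isCore {F : Formula n} {ψ : Assignment n} {t : ℝ} (ht : 0 < t)
    (hF : IsProportional F (t / 10))
    (hB : 10 * ((lowSupport F ψ (2 * t)).card : ℝ) ≤ (n : ℝ) / 10 ^ 6) :
    ∃ H : Finset (Fin n), IsCore F ψ t H ∧
      (n : ℝ) - 10 * ((lowSupport F ψ (2 * t)).card : ℝ) ≤ (H.card : ℝ) := by
  classical
  set B := lowSupport F ψ (2 * t) with hBdef
  -- A maximal `U` plays the role of the final set of a greedy closure: start from `B` and add
  -- variables that violate self-containment, each raising the excess by more than `t / 3`, up to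
  -- size `10 * B.card`.
  let 𝒰 : Finset (Finset (Fin n)) := Finset.univ.filter fun U =>
    B ⊆ U ∧ U.card ≤ 10 * B.card ∧ t / 3 * ((U.card : ℝ) - B.card) ≤ excess F U
  have h𝒰 : 𝒰.Nonempty := ⟨B, by simp [𝒰]; omega⟩
  obtain ⟨U, hU, hmax⟩ := Finset.exists_max_image 𝒰 Finset.card h𝒰
  obtain ⟨hBU, hUc, hUe⟩ := (Finset.mem_filter.1 hU).2
  have hself : IsSelfContained F (t / 3) Uᶜ := by
    intro x hx
    by_contra! hlt
    rw [Finset.mem_compl] at hx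
    have heq : (F \ induced F Uᶜ).filter (fun C => x ∈ vars C)
        = F.filter fun C => x ∈ vars C ∧ (vars C ∩ U).Nonempty := by
      ext C
      rw [Finset.mem_filter, mem_sdiff_induced_compl, Finset.mem_filter]
      tauto
    rw [heq] at hlt
    have hins := excess_insert F hx
    -- At full size the excess is at least `3 * t * B.card`. Each clause contributes at most 2, so
    -- at least `1.5 * t * B.card` clauses contain two variables of `U`, while proportionality
    -- allows fewer than `t * B.card`. Below full size, `insert x U` contradicts maximality.
    by_cases hcard : U.card = 10 * B.card
    · rcases U.eq_empty_or_nonempty with rfl | hne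
      · simp at hlt
        linarith
      · refine hF ⟨U, hne, ?_, ?_⟩
        · rw [hcard]; push_cast; exact hB
        · have h1 : (excess F U : ℝ) ≤ 2 * (F.filter fun C => 2 ≤ (vars C ∩ U).card).card := by
            exact_mod_cast excess_le F U
          have h2 : (U.card : ℝ) = 10 * B.card := by exact_mod_cast hcard
          have h3 : 0 ≤ t * (B.card : ℝ) := by positivity
          rw [h2] at hUe ⊢
          nlinarith
    · have hmem : insert x U ∈ 𝒰 := by
        refine Finset.mem_filter.2 ⟨Finset.mem_univ _, hBU.trans (Finset.subset_insert _ _), ?_, ?_⟩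
        · rw [Finset.card_insert_of_notMem hx]; omega
        · rw [Finset.card_insert_of_notMem hx]
          have : (excess F U : ℝ) + (F.filter fun C => x ∈ vars C ∧ (vars C ∩ U).Nonempty).card
              ≤ excess F (insert x U) := by exact_mod_cast hins
          push_cast
          linarith
      have := hmax _ hmem
      rw [Finset.card_insert_of_notMem hx] at this
      omega
  refine ⟨Uᶜ, ⟨fun x hx => ?_, hself⟩, ?_⟩
  -- Of at least `2 * t` supported clauses, self-containment loses at most `t / 3`.
  · have hxB : x ∉ B := fun h => Finset.mem_compl.1 hx (hBU h)
    have h2 : 2 * t ≤ ((F.filter fun C => Supports ψ x C).card : ℝ) := by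
      simpa [hBdef, lowSupport] using hxB
    have h3 := hself x hx
    have h4 : (F.filter fun C => Supports ψ x C).card
        ≤ ((induced F Uᶜ).filter fun C => Supports ψ x C).card
          + ((F \ induced F Uᶜ).filter fun C => x ∈ vars C).card := by
      refine (Finset.card_le_card fun C hC => ?_).trans (Finset.card_union_le _ _)
      obtain ⟨hCF, hCs⟩ := Finset.mem_filter.1 hC
      by_cases hCi : C ∈ induced F Uᶜ
      · exact Finset.mem_union_left _ (Finset.mem_filter.2 ⟨hCi, hCs⟩)
      · exact Finset.mem_union_right _
          (Finset.mem_filter.2 ⟨Finset.mem_sdiff.2 ⟨hCF, hCi⟩, hCs.mem_vars⟩)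
    have h4' : ((F.filter fun C => Supports ψ x C).card : ℝ)
        ≤ ((induced F Uᶜ).filter fun C => Supports ψ x C).card
          + ((F \ induced F Uᶜ).filter fun C => x ∈ vars C).card := by exact_mod_cast h4
    linarith
  · have h1 : U.card + Uᶜ.card = n := by
      rw [Finset.card_add_card_compl, Fintype.card_fin]
    have h1' : (U.card : ℝ) + Uᶜ.card = n := by exact_mod_cast h1
    have h2 : (U.card : ℝ) ≤ 10 * B.card := by exact_mod_cast hUc
    linarith

/-! ### Freezing -/

/-- In a proportional formula, satisfying assignments that differ in few variables agree on
expanding sets. -/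
theorem IsExpanding.eqOn {F : Formula n} {ψ ψ' : Assignment n} {t : ℝ} {H : Finset (Fin n)}
    (hH : IsExpanding F ψ t H) (ht : 0 < t) (hF : IsProportional F (t / 10))
    (hψ' : Satisfies ψ' F)
    (hd : ((Finset.univ.filter fun x => ψ x ≠ ψ' x).card : ℝ) ≤ (n : ℝ) / 10 ^ 6) :
    ∀ x ∈ H, ψ x = ψ' x := by
  classical
  by_contra! hne
  set W := H.filter fun x => ψ x ≠ ψ' x with hW
  have hWne : W.Nonempty := by
    obtain ⟨x, hx, hx'⟩ := hne
    exact ⟨x, Finset.mem_filter.2 ⟨hx, hx'⟩⟩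
  have hWd : (W.card : ℝ) ≤ (n : ℝ) / 10 ^ 6 := by
    refine le_trans ?_ hd
    exact_mod_cast Finset.card_le_card (Finset.filter_subset_filter _ (Finset.subset_univ _))
  refine hF ⟨W, hWne, hWd, ?_⟩
  have hdisj : (W : Set (Fin n)).PairwiseDisjoint
      fun x => (induced F H).filter fun C => Supports ψ x C := by
    intro x _ y _ hxy
    refine Finset.disjoint_left.2 fun C hC hC' => hxy ?_
    exact (Finset.mem_filter.1 hC).2.eq (Finset.mem_filter.1 hC').2
  -- `ψ'` falsifies the supporting literal, so it must make true another literal of the clause, one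
  -- false under `ψ`. Its variable lies in `H` and changes value, hence is a second variable in `W`.
  have hsub : (W.biUnion fun x => (induced F H).filter fun C => Supports ψ x C)
      ⊆ F.filter fun C => 2 ≤ (vars C ∩ W).card := by
    intro C hC
    obtain ⟨x, hxW, hC⟩ := Finset.mem_biUnion.1 hC
    obtain ⟨hCi, hCs⟩ := Finset.mem_filter.1 hC
    obtain ⟨hCF, hCH⟩ := Finset.mem_filter.1 hCi
    refine Finset.mem_filter.2 ⟨hCF, ?_⟩
    obtain ⟨l, hl, hlt⟩ := hψ' C hCF
    have hxd : ψ x ≠ ψ' x := (Finset.mem_filter.1 hxW).2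
    have hlv : l.1 ∈ vars C := Finset.mem_image_of_mem _ hl
    have hlx : l.1 ≠ x := by
      rintro rfl
      obtain ⟨⟨l', hl', hl'1, hl't⟩, -⟩ := hCs
      have hinj : Set.InjOn Prod.fst (C.1 : Set (Fin n × Bool)) :=
        Finset.card_image_iff.1 (C.2.2.trans C.2.1.symm)
      have : l' = l := hinj hl' hl hl'1
      subst this
      exact hxd (hl't.trans hlt.symm)
    have hlne : ¬ LitTrue ψ l := fun h => hlx (hCs.2 l hl h)
    have hlW : l.1 ∈ W := Finset.mem_filter.2 ⟨hCH hlv, fun h => hlne (h.trans hlt)⟩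
    refine Finset.one_lt_card.2 ⟨l.1, Finset.mem_inter.2 ⟨hlv, hlW⟩, x,
      Finset.mem_inter.2 ⟨hCs.mem_vars, hxW⟩, hlx⟩
  have h1 : (∑ x ∈ W, (((induced F H).filter fun C => Supports ψ x C).card : ℝ))
      ≤ ((F.filter fun C => 2 ≤ (vars C ∩ W).card).card : ℝ) := by
    rw [← Nat.cast_sum, ← Finset.card_biUnion hdisj]
    exact_mod_cast Finset.card_le_card hsub
  have h2 : (W.card : ℝ) * t
      ≤ ∑ x ∈ W, (((induced F H).filter fun C => Supports ψ x C).card : ℝ) := by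
    rw [← nsmul_eq_mul]
    exact Finset.card_nsmul_le_sum _ _ _ fun x hx => hH x (Finset.mem_filter.1 hx).1
  have h3 : 0 ≤ (W.card : ℝ) * t := by positivity
  linarith

theorem hasLargeFrozenCore_of {F : Formula n} {ψ : Assignment n} {t s : ℝ} (ht : 0 < t)
    (hψ : Satisfies ψ F) (hF : IsProportional F (t / 10))
    (hB : 10 * ((lowSupport F ψ (2 * t)).card : ℝ) ≤ (n : ℝ) / 10 ^ 6)
    (hs : s ≤ (n : ℝ) - 10 * ((lowSupport F ψ (2 * t)).card : ℝ))
    (hd : ∀ ψ', Satisfies ψ' F →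
      ((Finset.univ.filter fun x => ψ x ≠ ψ' x).card : ℝ) ≤ (n : ℝ) / 10 ^ 6) :
    HasLargeFrozenCore F t s := by
  obtain ⟨H, hH, hHc⟩ := exists_isCore ht hF hB
  refine ⟨ψ, H, hψ, hH, hs.trans hHc, fun x hx ψ₁ ψ₂ h₁ h₂ => ?_, hF⟩
  exact (hH.1.eqOn ht hF h₁ (hd _ h₁) x hx).symm.trans (hH.1.eqOn ht hF h₂ (hd _ h₂) x hx)

/-! ### Expectations over the coin tosses -/

/-- The expectation of `h` over the set of successful coin tosses. -/
noncomputable def expect (p : ℝ) (h : Formula n → ℝ) : ℝ := ∑ S, coinProb p S * h S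

lemma coinProb_nonneg {p : ℝ} (h0 : 0 ≤ p) (h1 : p ≤ 1) (S : Formula n) : 0 ≤ coinProb p S :=
  mul_nonneg (pow_nonneg h0 _) (pow_nonneg (sub_nonneg.2 h1) _)

lemma coinProb_eq_prod (p : ℝ) (S : Formula n) :
    coinProb p S = ∏ C : Clause n, if C ∈ S then p else 1 - p := by
  rw [Finset.prod_ite, Finset.prod_const, Finset.prod_const, Finset.filter_mem_eq_inter,
    Finset.univ_inter, Finset.filter_not, Finset.filter_mem_eq_inter, Finset.univ_inter,
    Finset.card_univ_sdiff, coinProb]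

lemma expect_mono {p : ℝ} (h0 : 0 ≤ p) (h1 : p ≤ 1) {f g : Formula n → ℝ} (h : ∀ S, f S ≤ g S) :
    expect p f ≤ expect p g :=
  Finset.sum_le_sum fun S _ => mul_le_mul_of_nonneg_left (h S) (coinProb_nonneg h0 h1 S)

lemma expect_nonneg {p : ℝ} (h0 : 0 ≤ p) (h1 : p ≤ 1) {f : Formula n → ℝ} (h : ∀ S, 0 ≤ f S) :
    0 ≤ expect p f :=
  Finset.sum_nonneg fun S _ => mul_nonneg (coinProb_nonneg h0 h1 S) (h S)

lemma expect_const_mul (p a : ℝ) (f : Formula n → ℝ) :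
    expect p (fun S => a * f S) = a * expect p f := by
  simp only [expect, Finset.mul_sum]
  exact Finset.sum_congr rfl fun S _ => by ring

lemma expect_add (p : ℝ) (f g : Formula n → ℝ) :
    expect p (fun S => f S + g S) = expect p f + expect p g := by
  simp only [expect, ← Finset.sum_add_distrib, mul_add]

lemma expect_sub (p : ℝ) (f g : Formula n → ℝ) :
    expect p (fun S => f S - g S) = expect p f - expect p g := by
  simp only [expect, ← Finset.sum_sub_distrib, mul_sub]

lemma expect_sum (p : ℝ) {ι : Type*} (s : Finset ι) (f : ι → Formula n → ℝ) :
    expect p (fun S => ∑ i ∈ s, f i S) = ∑ i ∈ s, expect p (f i) := by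
  simp only [expect, Finset.mul_sum]
  exact Finset.sum_comm

/-- The binomial generating function. It is used with `a = 0` for emptiness, `a = 1/2` for a lower
tail and `a ≥ 1` for an upper tail. -/
lemma expect_pow_card_inter (p a : ℝ) (T : Formula n) :
    expect p (fun S => a ^ (S ∩ T).card) = (1 - p + p * a) ^ T.card := by
  have h := Fintype.prod_add (fun C : Clause n => p * if C ∈ T then a else 1) (fun _ => 1 - p)
  have h1 : ∏ C : Clause n, ((p * if C ∈ T then a else 1) + (1 - p))
      = (1 - p + p * a) ^ T.card := by
    have : ∀ C : Clause n, ((p * if C ∈ T then a else 1) + (1 - p))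
        = if C ∈ T then 1 - p + p * a else 1 := fun C => by split_ifs <;> ring
    simp only [this, Finset.prod_ite, Finset.prod_const, one_pow, mul_one]
    simp
  rw [← h1, h, expect]
  refine Finset.sum_congr rfl fun S _ => ?_
  rw [Finset.prod_mul_distrib, Finset.prod_const, Finset.prod_const, Finset.card_compl, coinProb,
    Finset.prod_ite, Finset.prod_const, Finset.prod_const, one_pow, mul_one,
    Finset.filter_mem_eq_inter]
  ring

lemma expect_const (p a : ℝ) : expect p (fun _ : Formula n => a) = a := by
  have h := expect_pow_card_inter p 1 (∅ : Formula n)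
  have h2 := expect_const_mul p a (fun _ : Formula n => (1 : ℝ))
  simp only [one_pow, Finset.card_empty, pow_zero, mul_one] at h h2
  rw [h2, h, mul_one]

/-! ### Correlation inequalities -/

/-- `f` is increasing in the coins of the clauses satisfied by `ψ` and decreasing in the others. -/
def IsIncreasing (ψ : Assignment n) (f : Formula n → ℝ) : Prop :=
  ∀ S S' : Formula n, S ∩ satClauses ψ ⊆ S' → S' \ satClauses ψ ⊆ S → f S ≤ f S'

open scoped symmDiff in
/-- Harris' inequality. -/
theorem IsIncreasing.expect_mul_le {ψ : Assignment n} {f g : Formula n → ℝ}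
    (hf : IsIncreasing ψ f) (hg : IsIncreasing ψ g) (hf0 : ∀ S, 0 ≤ f S) (hg0 : ∀ S, 0 ≤ g S)
    {p : ℝ} (h0 : 0 ≤ p) (h1 : p ≤ 1) :
    expect p f * expect p g ≤ expect p (fun S => f S * g S) := by
  -- Symmetric difference with `Q` flips the coins of the clauses false under `ψ`, which turns
  -- `IsIncreasing` into ordinary monotonicity. The flipped law is still a product measure, so the
  -- lattice condition of `fkg` holds with equality.
  set Q : Formula n := (satClauses ψ)ᶜ with hQ
  have hmono : ∀ h : Formula n → ℝ, IsIncreasing ψ h → Monotone fun T => h (T ∆ Q) := by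
    intro h hh T T' hTT'
    refine hh _ _ (fun C hC => ?_) (fun C hC => ?_) <;>
    · have hC' : C ∈ T → C ∈ T' := fun h => hTT' h
      simp only [Finset.mem_inter, Finset.mem_sdiff, Finset.mem_symmDiff, hQ,
        Finset.mem_compl] at hC ⊢
      by_cases h1 : C ∈ T <;> by_cases h2 : C ∈ T' <;> by_cases h3 : C ∈ satClauses ψ <;>
        simp only [h1, h2, h3, not_true, not_false_iff, and_self, and_true, and_false, or_false,
          or_true, true_imp_iff] at hC hC' ⊢
  have hsum : ∀ h : Formula n → ℝ, ∑ T, coinProb p (T ∆ Q) * h (T ∆ Q) = expect p h := by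
    intro h
    have hinv : Function.Involutive fun T : Formula n => T ∆ Q :=
      fun T => symmDiff_symmDiff_cancel_right Q T
    exact Fintype.sum_bijective _ hinv.bijective _ _ fun T => rfl
  have hmod : ∀ a b : Formula n, coinProb p (a ∆ Q) * coinProb p (b ∆ Q)
      ≤ coinProb p ((a ⊓ b) ∆ Q) * coinProb p ((a ⊔ b) ∆ Q) := by
    intro a b
    refine le_of_eq ?_
    simp only [coinProb_eq_prod, ← Finset.prod_mul_distrib]
    refine Finset.prod_congr rfl fun C _ => ?_
    by_cases ha : C ∈ a <;> by_cases hb : C ∈ b <;> by_cases hc : C ∈ Q <;>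
      simp [Finset.mem_symmDiff, ha, hb, hc, mul_comm]
  have h := fkg (μ := fun T : Formula n => coinProb p (T ∆ Q)) (f := fun T => f (T ∆ Q))
    (g := fun T => g (T ∆ Q)) (fun T => coinProb_nonneg h0 h1 _) (fun T => hf0 _) (fun T => hg0 _)
    (hmono f hf) (hmono g hg) hmod
  have hone : ∑ T : Formula n, coinProb p (T ∆ Q) = 1 := by
    have := hsum fun _ => 1
    simpa [expect_const] using this
  rw [hone, one_mul, hsum f, hsum g, hsum fun S => f S * g S] at h
  exact h

theorem IsIncreasing.expect_mul_le_of_neg {ψ : Assignment n} {f g : Formula n → ℝ} {M : ℝ}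
    (hf : IsIncreasing ψ f) (hg : IsIncreasing ψ fun S => -g S) (hf0 : ∀ S, 0 ≤ f S)
    (hgM : ∀ S, g S ≤ M) {p : ℝ} (h0 : 0 ≤ p) (h1 : p ≤ 1) :
    expect p (fun S => f S * g S) ≤ expect p f * expect p g := by
  have hg' : IsIncreasing ψ fun S => M - g S := fun S S' h h' => by
    have := hg S S' h h'
    simp only at this ⊢
    linarith
  have h := hf.expect_mul_le hg' hf0 (fun S => sub_nonneg.2 (hgM S)) h0 h1
  have e1 : expect p (fun S => f S * (M - g S)) = M * expect p f - expect p fun S => f S * g S := by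
    rw [← expect_const_mul, ← expect_sub]
    congr 1
    ext S
    ring
  rw [expect_sub, expect_const, e1] at h
  linarith

/-! ### The expected number of satisfying assignments -/

open Classical in
/-- The indicator of the event that `ψ` satisfies the formula produced by the process. -/
noncomputable def satInd (σ : ClauseOrder n) (ψ : Assignment n) (S : Formula n) : ℝ :=
  if Satisfies ψ (process σ S) then 1 else 0

lemma satInd_nonneg (σ : ClauseOrder n) (ψ : Assignment n) (S : Formula n) :
    0 ≤ satInd σ ψ S := by
  unfold satInd
  split_ifs <;> norm_num

lemma isIncreasing_satInd (σ : ClauseOrder n) (ψ : Assignment n) :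
    IsIncreasing ψ (satInd σ ψ) := by
  intro S S' h h'
  unfold satInd
  split_ifs with h1 h2
  · exact le_rfl
  · exact absurd (satisfies_process_of_le h h' h1) h2
  · norm_num
  · exact le_rfl

open Classical in
/-- The number of satisfying assignments of `F`. -/
noncomputable def numSat (F : Formula n) : ℕ :=
  (Finset.univ.filter fun ψ : Assignment n => Satisfies ψ F).card

lemma numSat_pos {F : Formula n} (h : Satisfiable F) : 0 < numSat F := by
  obtain ⟨ψ, hψ⟩ := h
  exact Finset.card_pos.2 ⟨ψ, by simpa using hψ⟩

lemma satisfiable_inter_satClauses (ψ : Assignment n) (S : Formula n) :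
    Satisfiable (S ∩ satClauses ψ) :=
  ⟨ψ, satisfies_iff_subset.2 Finset.inter_subset_right⟩

lemma isIncreasing_inv_numSat (ψ : Assignment n) :
    IsIncreasing ψ fun S => ((numSat (S ∩ satClauses ψ) : ℝ))⁻¹ := by
  intro S S' h _
  have h0 := numSat_pos (satisfiable_inter_satClauses ψ S')
  have : numSat (S' ∩ satClauses ψ) ≤ numSat (S ∩ satClauses ψ) := by
    refine Finset.card_le_card fun φ hφ => ?_
    simp only [Finset.mem_filter, Finset.mem_univ, true_and] at hφ ⊢
    exact hφ.mono (Finset.subset_inter h Finset.inter_subset_right)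
  exact inv_anti₀ (by exact_mod_cast h0) (by exact_mod_cast this)

/-- If every planted formula has at most `m` satisfying assignments on average, then so has
the formula produced by the process. -/
theorem sum_expect_satInd_le {σ : ClauseOrder n} {p m : ℝ} (h0 : 0 ≤ p) (h1 : p ≤ 1) (hm : 0 < m)
    (h : ∀ ψ : Assignment n, expect p (fun S => (numSat (S ∩ satClauses ψ) : ℝ)) ≤ m) :
    ∑ ψ : Assignment n, expect p (satInd σ ψ) ≤ m := by
  -- Jensen's inequality for the reciprocal, through its tangent line at `m`: `N⁻¹ ≥ 2 * m⁻¹ - m⁻¹ ^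
  -- 2 * N`.
  have hinv : ∀ ψ : Assignment n,
      m⁻¹ ≤ expect p fun S => ((numSat (S ∩ satClauses ψ) : ℝ))⁻¹ := by
    intro ψ
    have hle : expect p (fun S => 2 * m⁻¹ - (m⁻¹) ^ 2 * (numSat (S ∩ satClauses ψ) : ℝ))
        ≤ expect p fun S => ((numSat (S ∩ satClauses ψ) : ℝ))⁻¹ := by
      refine expect_mono h0 h1 fun S => ?_
      have hN : (0 : ℝ) < numSat (S ∩ satClauses ψ) := by
        exact_mod_cast numSat_pos (satisfiable_inter_satClauses ψ S)
      generalize (numSat (S ∩ satClauses ψ) : ℝ) = N at hN ⊢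
      have h2 : 0 ≤ N * (N⁻¹ - m⁻¹) ^ 2 := by positivity
      have h3 : N * (N⁻¹ - m⁻¹) ^ 2 = N⁻¹ - (2 * m⁻¹ - (m⁻¹) ^ 2 * N) := by
        field_simp
        ring
      linarith
    rw [expect_sub, expect_const, expect_const_mul] at hle
    have h2 : (m⁻¹) ^ 2 * expect p (fun S => (numSat (S ∩ satClauses ψ) : ℝ)) ≤ (m⁻¹) ^ 2 * m :=
      mul_le_mul_of_nonneg_left (h ψ) (by positivity)
    have h3 : (m⁻¹) ^ 2 * m = m⁻¹ := by field_simp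
    linarith
  -- For each `S`, every solution of the output has weight one over the number of solutions, since
  -- its planted formula is the output.
  have hone : ∑ ψ : Assignment n,
      expect p (fun S => satInd σ ψ S * ((numSat (S ∩ satClauses ψ) : ℝ))⁻¹) = 1 := by
    rw [← expect_sum, ← expect_const (n := n) p 1]
    congr 1
    ext S
    have h2 : ∀ ψ : Assignment n, satInd σ ψ S * ((numSat (S ∩ satClauses ψ) : ℝ))⁻¹
        = satInd σ ψ S * ((numSat (process σ S) : ℝ))⁻¹ := by
      intro ψ
      by_cases hψ : Satisfies ψ (process σ S)
      · rw [process_eq_inter hψ]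
      · simp [satInd, hψ]
    have h3 : ∑ ψ : Assignment n, satInd σ ψ S = numSat (process σ S) := by
      simp [satInd, numSat]
    have h4 : (0 : ℝ) < numSat (process σ S) := by
      exact_mod_cast numSat_pos (satisfiable_process σ S)
    rw [Finset.sum_congr rfl fun ψ _ => h2 ψ, ← Finset.sum_mul, h3, mul_inv_cancel₀ h4.ne']
  have hle : (∑ ψ : Assignment n, expect p (satInd σ ψ)) * m⁻¹ ≤ 1 := by
    rw [← hone, Finset.sum_mul]
    refine Finset.sum_le_sum fun ψ _ => ?_
    refine le_trans ?_ ((isIncreasing_satInd σ ψ).expect_mul_le (isIncreasing_inv_numSat ψ)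
      (satInd_nonneg σ ψ) (fun S => by positivity) h0 h1)
    exact mul_le_mul_of_nonneg_left (hinv ψ) (expect_nonneg h0 h1 (satInd_nonneg σ ψ))
  rwa [← div_eq_mul_inv, div_le_one hm] at hle

/-! ### Counting clauses -/

/-- The clause with variables `T` whose literals are the ones that are true under `φ`. -/
def clauseOf (φ : Assignment n) (T : Finset (Fin n)) (hT : T.card = 3) : Clause n :=
  ⟨T.image fun x => (x, φ x), by
    have h1 : (T.image fun x => (x, φ x)).card = 3 := by
      rw [Finset.card_image_of_injective _ fun x y h => (Prod.ext_iff.1 h).1, hT]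
    refine ⟨h1, ?_⟩
    rw [Finset.image_image]
    simpa [Function.comp_def] using hT⟩

lemma vars_clauseOf (φ : Assignment n) (T : Finset (Fin n)) (hT : T.card = 3) :
    vars (clauseOf φ T hT) = T := by
  simp [vars, clauseOf, Finset.image_image, Function.comp_def]

lemma eq_of_fst_eq {C : Clause n} {l l' : Fin n × Bool} (hl : l ∈ C.1) (hl' : l' ∈ C.1)
    (h : l.1 = l'.1) : l = l' := by
  have hinj : Set.InjOn Prod.fst (C.1 : Set (Fin n × Bool)) :=
    Finset.card_image_iff.1 (C.2.2.trans C.2.1.symm)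
  exact hinj hl hl' h

open Classical in
/-- The clauses supported by `x`. -/
noncomputable def suppClauses (ψ : Assignment n) (x : Fin n) : Formula n :=
  Finset.univ.filter fun C => Supports ψ x C

lemma mem_suppClauses {ψ : Assignment n} {x : Fin n} {C : Clause n} :
    C ∈ suppClauses ψ x ↔ Supports ψ x C := by
  simp [suppClauses]

lemma choose_le_card_suppClauses (ψ : Assignment n) (x : Fin n) :
    (n - 1).choose 2 ≤ (suppClauses ψ x).card := by
  have h : (Finset.powersetCard 2 (Finset.univ.erase x)).card = (n - 1).choose 2 := by
    rw [Finset.card_powersetCard, Finset.card_erase_of_mem (Finset.mem_univ x), Finset.card_univ,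
      Fintype.card_fin]
  rw [← h]
  refine Finset.card_le_card_of_surjOn (fun C => (vars C).erase x) fun P hP => ?_
  obtain ⟨hPx, hPc⟩ := Finset.mem_powersetCard.1 hP
  have hx : x ∉ P := fun h => Finset.notMem_erase x _ (hPx h)
  have hT : (insert x P).card = 3 := by rw [Finset.card_insert_of_notMem hx, hPc]
  -- The literals are false under `ψ` except the one at `x`.
  refine ⟨clauseOf (Function.update (fun y => !ψ y) x (ψ x)) (insert x P) hT, ?_, ?_⟩
  · refine mem_suppClauses.2 ⟨⟨(x, ψ x), ?_, rfl, rfl⟩, fun l hl hlt => ?_⟩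
    · exact Finset.mem_image.2 ⟨x, Finset.mem_insert_self _ _, by simp⟩
    · obtain ⟨y, -, rfl⟩ := Finset.mem_image.1 hl
      by_contra hy
      simp only [LitTrue, Function.update_of_ne hy] at hlt
      simp at hlt
  · simp only [vars_clauseOf]
    exact Finset.erase_insert hx

/-- The number of variables on which two assignments differ. -/
def diff (ψ ψ' : Assignment n) : ℕ := (Finset.univ.filter fun x => ψ x ≠ ψ' x).card

/-- If `ψ x ≠ ψ' x`, a clause supported by `x` under `ψ'` flipped at `x` is true under `ψ` and false
under `ψ'`. Each clause is counted at most three times, once for each of its variables. -/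
lemma diff_mul_choose_le (ψ ψ' : Assignment n) :
    diff ψ ψ' * (n - 1).choose 2 ≤ 3 * (satClauses ψ \ satClauses ψ').card := by
  classical
  set D := satClauses ψ \ satClauses ψ' with hD
  have h1 : ∑ x, (D.filter fun C => x ∈ vars C).card = 3 * D.card := by
    have := Finset.sum_card_bipartiteAbove_eq_sum_card_bipartiteBelow
      (s := (Finset.univ : Finset (Fin n))) (t := D) (r := fun x C => x ∈ vars C)
    simp only [Finset.bipartiteAbove, Finset.bipartiteBelow] at this
    rw [this, mul_comm, ← smul_eq_mul, ← Finset.sum_const]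
    refine Finset.sum_congr rfl fun C _ => ?_
    rw [Finset.filter_mem_eq_inter, Finset.univ_inter, card_vars]
  rw [← h1, diff, ← smul_eq_mul]
  refine (Finset.card_nsmul_le_sum _ _ _ fun x hx => ?_).trans
    (Finset.sum_le_sum_of_subset (Finset.subset_univ (Finset.univ.filter fun x => ψ x ≠ ψ' x)))
  have hx' : ψ x ≠ ψ' x := (Finset.mem_filter.1 hx).2
  refine (choose_le_card_suppClauses (Function.update ψ' x (ψ x)) x).trans
    (Finset.card_le_card fun C hC => ?_)
  have hC' := mem_suppClauses.1 hC
  refine Finset.mem_filter.2 ⟨Finset.mem_sdiff.2 ?_, hC'.mem_vars⟩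
  obtain ⟨⟨l, hl, rfl, hlt⟩, hall⟩ := hC'
  have hlt' : ψ l.1 = l.2 := by simpa [LitTrue] using hlt
  refine ⟨mem_satClauses.2 ⟨l, hl, hlt'⟩, fun h => ?_⟩
  obtain ⟨l', hl', hlt''⟩ := mem_satClauses.1 h
  by_cases he : l'.1 = l.1
  · have := eq_of_fst_eq hl' hl he
    subst this
    exact hx' (hlt'.trans hlt''.symm)
  · refine he (hall l' hl' ?_)
    simpa [LitTrue, Function.update_of_ne he] using hlt''

/-- The clauses that contain at least two variables of `U`. -/
def pairClauses (U : Finset (Fin n)) : Formula n :=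
  Finset.univ.filter fun C => 2 ≤ (vars C ∩ U).card

/-- Two literals over `U` and one arbitrary literal: `(2 * u) ^ 2 * (2 * n)` choices. -/
lemma card_pairClauses_le (U : Finset (Fin n)) :
    (pairClauses U).card ≤ 8 * U.card ^ 2 * n := by
  let lits : Finset ((Fin n × Bool) × (Fin n × Bool) × (Fin n × Bool)) :=
    (U ×ˢ Finset.univ) ×ˢ (U ×ˢ Finset.univ) ×ˢ Finset.univ
  have hsub : (pairClauses U).image Subtype.val ⊆ lits.image fun l => {l.1, l.2.1, l.2.2} := by
    intro c hc
    obtain ⟨C, hC, rfl⟩ := Finset.mem_image.1 hc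
    obtain ⟨x, hx, y, hy, hxy⟩ := Finset.one_lt_card.1 (Finset.mem_filter.1 hC).2
    obtain ⟨hxC, hxU⟩ := Finset.mem_inter.1 hx
    obtain ⟨hyC, hyU⟩ := Finset.mem_inter.1 hy
    obtain ⟨l, hl, rfl⟩ := Finset.mem_image.1 hxC
    obtain ⟨l', hl', rfl⟩ := Finset.mem_image.1 hyC
    have hne : l' ≠ l := fun h => hxy (by rw [h])
    have hl'e : l' ∈ C.1.erase l := Finset.mem_erase.2 ⟨hne, hl'⟩
    have hcard : ((C.1.erase l).erase l').card = 1 := by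
      rw [Finset.card_erase_of_mem hl'e, Finset.card_erase_of_mem hl, C.2.1]
    obtain ⟨l'', hl''⟩ := Finset.card_eq_one.1 hcard
    refine Finset.mem_image.2 ⟨(l, l', l''), ?_, ?_⟩
    · simp [lits, hxU, hyU]
    · simp only
      rw [← hl'', Finset.insert_erase hl'e, Finset.insert_erase hl]
  have h1 := Finset.card_le_card hsub
  rw [Finset.card_image_of_injective _ Subtype.val_injective] at h1
  refine (h1.trans Finset.card_image_le).trans (le_of_eq ?_)
  simp only [lits, Finset.card_product, Finset.card_univ, Fintype.card_prod, Fintype.card_bool,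
    Fintype.card_fin]
  ring

/-! ### Failure probabilities -/

lemma one_sub_pow_le_exp {p : ℝ} (h1 : p ≤ 1) {k : ℕ} {r : ℝ} (hr : r ≤ p * k) :
    (1 - p) ^ k ≤ Real.exp (-r) := by
  have h : 1 - p ≤ Real.exp (-p) := by
    have := Real.add_one_le_exp (-p)
    linarith
  calc (1 - p) ^ k ≤ Real.exp (-p) ^ k := pow_le_pow_left₀ (sub_nonneg.2 h1) h k
    _ = Real.exp (k * -p) := (Real.exp_nat_mul _ _).symm
    _ ≤ Real.exp (-r) := Real.exp_le_exp.2 (by linarith)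

lemma expect_zero_pow_card_inter (p : ℝ) (T : Formula n) :
    expect p (fun S => (0 : ℝ) ^ (S ∩ T).card) = (1 - p) ^ T.card := by
  rw [expect_pow_card_inter, mul_zero, add_zero]

/-- Since `0 ^ 0 = 1`, the integrand is the indicator that `ψ'` satisfies the formula planted at
`ψ`. -/
lemma expect_zero_pow_le {p : ℝ} (h0 : 0 ≤ p) (h1 : p ≤ 1) (ψ ψ' : Assignment n) :
    expect p (fun S => (0 : ℝ) ^ (S ∩ (satClauses ψ \ satClauses ψ')).card)
      ≤ Real.exp (-(p * (n - 1).choose 2 / 3 * diff ψ ψ')) := by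
  rw [expect_zero_pow_card_inter]
  refine one_sub_pow_le_exp h1 ?_
  have h : (diff ψ ψ' : ℝ) * (n - 1).choose 2 ≤ 3 * (satClauses ψ \ satClauses ψ').card := by
    exact_mod_cast diff_mul_choose_le ψ ψ'
  have := mul_le_mul_of_nonneg_left h h0
  linarith

lemma sum_pow_diff (ψ : Assignment n) (a : ℝ) :
    ∑ ψ' : Assignment n, a ^ diff ψ ψ' = (1 + a) ^ n := by
  have h1 : ∀ ψ' : Assignment n, a ^ diff ψ ψ' = ∏ x, if ψ x ≠ ψ' x then a else 1 := by
    intro ψ'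
    rw [Finset.prod_ite, Finset.prod_const, Finset.prod_const_one, mul_one, diff]
  have h2 := Finset.prod_univ_sum (fun _ : Fin n => (Finset.univ : Finset Bool))
    (fun x b => if ψ x ≠ b then a else 1)
  rw [Fintype.piFinset_univ] at h2
  rw [Finset.sum_congr rfl fun ψ' _ => h1 ψ', ← h2]
  have h3 : ∀ x, (∑ b : Bool, if ψ x ≠ b then a else 1) = 1 + a := by
    intro x
    cases ψ x <;> simp [add_comm]
  rw [Finset.prod_congr rfl fun x _ => h3 x, Finset.prod_const, Finset.card_univ,
    Fintype.card_fin]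

lemma inter_sdiff_eq_empty_iff {ψ ψ' : Assignment n} {S : Formula n} :
    S ∩ (satClauses ψ \ satClauses ψ') = ∅ ↔ Satisfies ψ' (S ∩ satClauses ψ) := by
  rw [satisfies_iff_subset, ← Finset.inter_sdiff_assoc, Finset.sdiff_eq_empty_iff_subset]

lemma expect_numSat_le {p : ℝ} (h0 : 0 ≤ p) (h1 : p ≤ 1) (ψ : Assignment n) :
    expect p (fun S => (numSat (S ∩ satClauses ψ) : ℝ))
      ≤ (1 + Real.exp (-(p * (n - 1).choose 2 / 3))) ^ n := by
  have h2 : ∀ S : Formula n, (numSat (S ∩ satClauses ψ) : ℝ)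
      = ∑ ψ' : Assignment n, (0 : ℝ) ^ (S ∩ (satClauses ψ \ satClauses ψ')).card := by
    intro S
    rw [numSat, ← Finset.sum_boole]
    refine Finset.sum_congr rfl fun ψ' _ => ?_
    rw [zero_pow_eq]
    classical
    exact if_congr (by rw [Finset.card_eq_zero, inter_sdiff_eq_empty_iff]) rfl rfl
  simp only [h2, expect_sum]
  rw [← sum_pow_diff ψ]
  refine Finset.sum_le_sum fun ψ' _ => (expect_zero_pow_le h0 h1 ψ ψ').trans (le_of_eq ?_)
  rw [← Real.exp_nat_mul]
  congr 1
  ring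

open Classical in
/-- The probability that two assignments that differ in many variables satisfy the same of the
clauses with successful coin tosses. -/
lemma expect_exists_diff_le {p : ℝ} (h0 : 0 ≤ p) (h1 : p ≤ 1) (r : ℝ) :
    expect p (fun S : Formula n => if ∃ ψ ψ' : Assignment n, r < diff ψ ψ' ∧
        Satisfies ψ' (S ∩ satClauses ψ) then 1 else 0)
      ≤ 4 ^ n * Real.exp (-(p * (n - 1).choose 2 / 3 * r)) := by
  have hle : ∀ S : Formula n, (if ∃ ψ ψ' : Assignment n, r < diff ψ ψ' ∧
        Satisfies ψ' (S ∩ satClauses ψ) then (1 : ℝ) else 0)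
      ≤ ∑ ψ : Assignment n, ∑ ψ' ∈ Finset.univ.filter fun ψ' => r < diff ψ ψ',
        (0 : ℝ) ^ (S ∩ (satClauses ψ \ satClauses ψ')).card := by
    intro S
    have hnn : ∀ ψ : Assignment n, 0 ≤ ∑ ψ' ∈ Finset.univ.filter fun ψ' => r < diff ψ ψ',
        (0 : ℝ) ^ (S ∩ (satClauses ψ \ satClauses ψ')).card :=
      fun ψ => Finset.sum_nonneg fun _ _ => by positivity
    split_ifs with h
    · obtain ⟨ψ, ψ', hr, hs⟩ := h
      refine le_trans ?_ (Finset.single_le_sum (fun ψ _ => hnn ψ) (Finset.mem_univ ψ))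
      refine le_trans ?_ (Finset.single_le_sum (fun _ _ => by positivity)
        (Finset.mem_filter.2 ⟨Finset.mem_univ ψ', hr⟩))
      rw [inter_sdiff_eq_empty_iff.2 hs, Finset.card_empty, pow_zero]
    · exact Finset.sum_nonneg fun ψ _ => hnn ψ
  refine (expect_mono h0 h1 hle).trans ?_
  simp only [expect_sum]
  have hcard : (Fintype.card (Assignment n) : ℝ) = 2 ^ n := by simp
  calc ∑ ψ : Assignment n, ∑ ψ' ∈ Finset.univ.filter fun ψ' => r < diff ψ ψ',
        expect p (fun S => (0 : ℝ) ^ (S ∩ (satClauses ψ \ satClauses ψ')).card)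
      ≤ ∑ ψ : Assignment n, ∑ _ψ' : Assignment n,
          Real.exp (-(p * (n - 1).choose 2 / 3 * r)) := by
        refine Finset.sum_le_sum fun ψ _ => ?_
        refine (Finset.sum_le_sum fun ψ' hψ' => ?_).trans (Finset.sum_le_sum_of_subset_of_nonneg
          (Finset.filter_subset _ _) fun _ _ _ => (Real.exp_pos _).le)
        refine (expect_zero_pow_le h0 h1 ψ ψ').trans (Real.exp_le_exp.2 (neg_le_neg ?_))
        exact mul_le_mul_of_nonneg_left (Finset.mem_filter.1 hψ').2.le (by positivity)
    _ = 4 ^ n * Real.exp (-(p * (n - 1).choose 2 / 3 * r)) := by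
        simp only [Finset.sum_const, Finset.card_univ, nsmul_eq_mul, hcard]
        rw [← mul_assoc, ← mul_pow]
        norm_num

open Classical in
/-- The probability that the process ends with a formula in which many variables have low
support. -/
lemma expect_lowSupport_le {p m : ℝ} (h0 : 0 ≤ p) (h1 : p ≤ 1) (hm : 0 < m)
    (h : ∀ ψ : Assignment n, expect p (fun S => (numSat (S ∩ satClauses ψ) : ℝ)) ≤ m)
    (σ : ClauseOrder n) (t k : ℕ) :
    expect p (fun S => if ∃ ψ, Satisfies ψ (process σ S) ∧
        k ≤ (lowSupport (process σ S) ψ (2 * t)).card then 1 else 0)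
      ≤ m * (n.choose k * (4 ^ t * Real.exp (-(p * (n - 1).choose 2 / 2))) ^ k) := by
  let T : Assignment n → Finset (Fin n) → Formula n := fun ψ K => K.biUnion (suppClauses ψ)
  -- An exponential Markov weight: if all `k` variables of `K` have low support, at most `2 * t * k`
  -- clauses of `T ψ K` are in `S`, and `4 ^ (t * k) * g ψ K S ≥ 1`.
  let g : Assignment n → Finset (Fin n) → Formula n → ℝ := fun ψ K S =>
    (1 / 2 : ℝ) ^ (S ∩ T ψ K).card
  have hT : ∀ ψ K, T ψ K ⊆ satClauses ψ := fun ψ K => Finset.biUnion_subset.2 fun x _ C hC =>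
    (mem_suppClauses.1 hC).mem_satClauses
  have hTc : ∀ ψ K, K.card * (n - 1).choose 2 ≤ (T ψ K).card := by
    intro ψ K
    rw [Finset.card_biUnion fun x _ y _ hxy => Finset.disjoint_left.2 fun C hC hC' =>
      hxy ((mem_suppClauses.1 hC).eq (mem_suppClauses.1 hC')), ← smul_eq_mul]
    exact Finset.card_nsmul_le_sum _ _ _ fun x _ => choose_le_card_suppClauses ψ x
  have hle : ∀ S, (if ∃ ψ, Satisfies ψ (process σ S) ∧
        k ≤ (lowSupport (process σ S) ψ (2 * t)).card then (1 : ℝ) else 0)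
      ≤ ∑ ψ : Assignment n, ∑ K ∈ Finset.powersetCard k Finset.univ,
        4 ^ (t * k) * (satInd σ ψ S * g ψ K S) := by
    intro S
    have hnn : ∀ ψ K, 0 ≤ (4 : ℝ) ^ (t * k) * (satInd σ ψ S * g ψ K S) := fun ψ K => by
      have := satInd_nonneg σ ψ S
      positivity
    split_ifs with hS
    · obtain ⟨ψ, hψ, hk⟩ := hS
      obtain ⟨K, hKs, hKc⟩ := Finset.exists_subset_card_eq hk
      refine le_trans ?_ (Finset.single_le_sum
        (fun ψ _ => Finset.sum_nonneg fun K _ => hnn ψ K) (Finset.mem_univ ψ))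
      refine le_trans ?_ (Finset.single_le_sum (fun K _ => hnn ψ K)
        (Finset.mem_powersetCard.2 ⟨Finset.subset_univ K, hKc⟩))
      have hcard : (S ∩ T ψ K).card ≤ 2 * t * k := by
        rw [Finset.inter_biUnion, ← hKc, mul_comm, ← smul_eq_mul]
        refine Finset.card_biUnion_le.trans (Finset.sum_le_card_nsmul _ _ _ fun x hx => ?_)
        have hlow := (Finset.mem_filter.1 (hKs hx)).2
        have heq : S ∩ suppClauses ψ x = (process σ S).filter fun C => Supports ψ x C := by
          rw [process_eq_inter hψ]
          ext C
          simp only [Finset.mem_inter, mem_suppClauses, Finset.mem_filter]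
          exact ⟨fun h => ⟨⟨h.1, h.2.mem_satClauses⟩, h.2⟩, fun h => ⟨h.1.1, h.2⟩⟩
        rw [heq]
        exact_mod_cast hlow.le
      have hg : (1 / 2 : ℝ) ^ (2 * t * k) ≤ g ψ K S :=
        pow_le_pow_of_le_one (by norm_num) (by norm_num) hcard
      have h1' : satInd σ ψ S = 1 := if_pos hψ
      rw [h1', one_mul]
      calc (1 : ℝ) = 4 ^ (t * k) * (1 / 2 : ℝ) ^ (2 * t * k) := by
            rw [mul_assoc 2 t k, pow_mul _ 2, ← mul_pow]
            norm_num
        _ ≤ _ := mul_le_mul_of_nonneg_left hg (by positivity)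
    · exact Finset.sum_nonneg fun ψ _ => Finset.sum_nonneg fun K _ => hnn ψ K
  refine (expect_mono h0 h1 hle).trans ?_
  simp only [expect_sum, expect_const_mul]
  have hharris : ∀ ψ K, K ∈ Finset.powersetCard k (Finset.univ : Finset (Fin n)) →
      expect p (fun S => satInd σ ψ S * g ψ K S)
        ≤ expect p (satInd σ ψ) * Real.exp (-(p * (n - 1).choose 2 / 2)) ^ k := by
    intro ψ K hK
    have hdec : IsIncreasing ψ fun S => -g ψ K S := by
      intro S S' hSS' _
      refine neg_le_neg (pow_le_pow_of_le_one (by norm_num) (by norm_num) (Finset.card_le_card ?_))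
      exact fun C hC => Finset.mem_inter.2
        ⟨hSS' (Finset.mem_inter.2 ⟨(Finset.mem_inter.1 hC).1, hT ψ K (Finset.mem_inter.1 hC).2⟩),
          (Finset.mem_inter.1 hC).2⟩
    refine ((isIncreasing_satInd σ ψ).expect_mul_le_of_neg hdec (satInd_nonneg σ ψ)
      (fun S => pow_le_one₀ (by norm_num) (by norm_num)) h0 h1).trans
      (mul_le_mul_of_nonneg_left ?_ (expect_nonneg h0 h1 (satInd_nonneg σ ψ)))
    rw [expect_pow_card_inter, ← Real.exp_nat_mul, show 1 - p + p * (1 / 2) = 1 - p / 2 by ring]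
    refine (one_sub_pow_le_exp (by linarith) (r := k * (p * (n - 1).choose 2 / 2)) ?_).trans
      (le_of_eq (by congr 1; ring))
    have h2 : (k : ℝ) * (n - 1).choose 2 ≤ (T ψ K).card := by
      rw [← (Finset.mem_powersetCard.1 hK).2]
      exact_mod_cast hTc ψ K
    have := mul_le_mul_of_nonneg_left h2 (by linarith : 0 ≤ p / 2)
    linarith
  calc ∑ ψ : Assignment n, ∑ K ∈ Finset.powersetCard k Finset.univ,
        4 ^ (t * k) * expect p (fun S => satInd σ ψ S * g ψ K S)
      ≤ ∑ ψ : Assignment n, ∑ _K ∈ Finset.powersetCard k (Finset.univ : Finset (Fin n)),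
        4 ^ (t * k) * (expect p (satInd σ ψ) * Real.exp (-(p * (n - 1).choose 2 / 2)) ^ k) :=
        Finset.sum_le_sum fun ψ _ => Finset.sum_le_sum fun K hK =>
          mul_le_mul_of_nonneg_left (hharris ψ K hK) (by positivity)
    -- The bound for `g` does not depend on `ψ`, so the sum over `ψ` reduces to the expected number
    -- of solutions.
    _ = (∑ ψ : Assignment n, expect p (satInd σ ψ))
        * (n.choose k * (4 ^ t * Real.exp (-(p * (n - 1).choose 2 / 2))) ^ k) := by
        simp only [Finset.sum_const, Finset.card_powersetCard, Finset.card_univ, Fintype.card_fin,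
          nsmul_eq_mul]
        rw [Finset.sum_mul]
        refine Finset.sum_congr rfl fun ψ _ => ?_
        rw [mul_pow, ← pow_mul]
        ring
    _ ≤ _ := mul_le_mul_of_nonneg_right (sum_expect_satInd_le h0 h1 hm h) (by positivity)

open Classical in
/-- The probability that the clauses with successful coin tosses are not proportional. -/
lemma expect_not_isProportional_le {p : ℝ} (h0 : 0 ≤ p) (h1 : p ≤ 1) (ρ : ℝ) :
    expect p (fun S : Formula n => if ¬ IsProportional S ρ then 1 else 0)
      ≤ ∑ u ∈ (Finset.range (n + 1)).filter (fun u : ℕ => 0 < u ∧ (u : ℝ) ≤ n / 10 ^ 6),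
        n.choose u * ((10 ^ 4 * u / n : ℝ) ^ (ρ * u) * Real.exp (8 * u * (n ^ 2 * p) / 10 ^ 4)) := by
  set good : ℕ → Prop := fun u : ℕ => 0 < u ∧ (u : ℝ) ≤ n / 10 ^ 6 with hgood
  -- This base makes the exponent `8 * u ^ 2 * n * p * lam u` linear in `u`.
  let lam : ℕ → ℝ := fun u => n / (10 ^ 4 * u)
  have hlam : ∀ u, good u → 1 ≤ lam u := by
    rintro u ⟨hu, hun⟩
    have hu' : (0 : ℝ) < u := by exact_mod_cast hu
    simp only [lam]
    rw [one_le_div (by positivity)]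
    rw [le_div_iff₀ (by positivity)] at hun
    linarith
  have hle : ∀ S : Formula n, (if ¬ IsProportional S ρ then (1 : ℝ) else 0)
      ≤ ∑ U ∈ (Finset.univ : Finset (Finset (Fin n))).filter (fun U => good U.card),
        (10 ^ 4 * U.card / n : ℝ) ^ (ρ * U.card) * lam U.card ^ (S ∩ pairClauses U).card := by
    intro S
    have hnn : ∀ U ∈ (Finset.univ : Finset (Finset (Fin n))).filter (fun U => good U.card),
        0 ≤ (10 ^ 4 * U.card / n : ℝ) ^ (ρ * U.card) * lam U.card ^ (S ∩ pairClauses U).card :=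
      fun U hU => mul_nonneg (by positivity)
        (pow_nonneg (zero_le_one.trans (hlam _ (Finset.mem_filter.1 hU).2)) _)
    split_ifs with hS
    · exact Finset.sum_nonneg hnn
    · obtain ⟨U, hU, hUn, hUS⟩ := not_not.1 hS
      have hg : good U.card := ⟨hU.card_pos, hUn⟩
      refine le_trans ?_ (Finset.single_le_sum hnn (Finset.mem_filter.2 ⟨Finset.mem_univ U, hg⟩))
      have heq : (S.filter fun C => 2 ≤ (vars C ∩ U).card) = S ∩ pairClauses U := by
        ext C; simp [pairClauses]
      rw [heq] at hUS
      have hl := hlam _ hg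
      have hinv : (10 ^ 4 * U.card / n : ℝ) = (lam U.card)⁻¹ := by simp only [lam, inv_div]
      rw [hinv, Real.inv_rpow (zero_le_one.trans hl), ← Real.rpow_natCast, ← div_eq_inv_mul,
        one_le_div (Real.rpow_pos_of_pos (zero_lt_one.trans_le hl) _)]
      exact Real.rpow_le_rpow_of_exponent_le hl hUS
  refine (expect_mono h0 h1 hle).trans ?_
  simp only [expect_sum, expect_const_mul, expect_pow_card_inter]
  have hterm : ∀ U ∈ (Finset.univ : Finset (Finset (Fin n))).filter (fun U => good U.card),
      (10 ^ 4 * U.card / n : ℝ) ^ (ρ * U.card)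
          * (1 - p + p * lam U.card) ^ (pairClauses U).card
        ≤ (10 ^ 4 * U.card / n : ℝ) ^ (ρ * U.card)
          * Real.exp (8 * U.card * (n ^ 2 * p) / 10 ^ 4) := by
    intro U hU
    have hg := (Finset.mem_filter.1 hU).2
    have hl := hlam _ hg
    have hu : (0 : ℝ) < U.card := by exact_mod_cast hg.1
    refine mul_le_mul_of_nonneg_left ?_ (by positivity)
    have h2 : 1 - p + p * lam U.card ≤ Real.exp (p * lam U.card) := by
      have := Real.add_one_le_exp (p * lam U.card)
      linarith
    have h3 : 0 ≤ 1 - p + p * lam U.card := by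
      have : 0 ≤ p * lam U.card := mul_nonneg h0 (by linarith)
      linarith
    refine (pow_le_pow_left₀ h3 h2 _).trans ?_
    rw [← Real.exp_nat_mul]
    refine Real.exp_le_exp.2 ?_
    have h4 : ((pairClauses U).card : ℝ) ≤ 8 * U.card ^ 2 * n := by
      exact_mod_cast card_pairClauses_le U
    refine (mul_le_mul_of_nonneg_right h4 (mul_nonneg h0 (by linarith))).trans (le_of_eq ?_)
    simp only [lam]
    field_simp
  refine (Finset.sum_le_sum hterm).trans (le_of_eq ?_)
  rw [Finset.sum_filter, Finset.sum_filter, ← Finset.powerset_univ]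
  have := Finset.sum_powerset_apply_card (fun u : ℕ => if good u then
    (10 ^ 4 * u / n : ℝ) ^ (ρ * u) * Real.exp (8 * u * (n ^ 2 * p) / 10 ^ 4) else 0)
    (x := (Finset.univ : Finset (Fin n)))
  rw [this, Finset.card_univ, Fintype.card_fin]
  refine Finset.sum_congr rfl fun u _ => ?_
  rw [nsmul_eq_mul, mul_ite, mul_zero]

/-! ### Estimates -/

lemma choose_le_exp_mul_pow (n : ℕ) {k : ℕ} (hk : 0 < k) :
    (n.choose k : ℝ) ≤ (Real.exp 1 * (n / k)) ^ k := by
  have hk' : (0 : ℝ) < k := by exact_mod_cast hk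
  have h1 : (n.choose k : ℝ) ≤ (n : ℝ) ^ k / k.factorial := Nat.choose_le_pow_div k n
  have h2 : (k : ℝ) ^ k / k.factorial ≤ Real.exp k := Real.pow_div_factorial_le_exp _ hk'.le k
  have h3 : (0 : ℝ) < k.factorial := by exact_mod_cast k.factorial_pos
  calc (n.choose k : ℝ) ≤ (n : ℝ) ^ k / k.factorial := h1
    _ = (n / k : ℝ) ^ k * ((k : ℝ) ^ k / k.factorial) := by
        rw [div_pow]
        field_simp
    _ ≤ (n / k : ℝ) ^ k * Real.exp k := mul_le_mul_of_nonneg_left h2 (by positivity)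
    _ = (Real.exp 1 * (n / k)) ^ k := by
        rw [mul_pow, ← Real.exp_nat_mul, mul_one, mul_comm]

lemma nat_cast_le_exp (k : ℕ) : (k : ℝ) ≤ Real.exp k := by
  have := Real.add_one_le_exp (k : ℝ)
  linarith

lemma le_choose_two (hn : 30 ≤ n) : 0.45 * (n : ℝ) ^ 2 ≤ ((n - 1).choose 2 : ℕ) := by
  obtain ⟨k, rfl⟩ : ∃ k, n = k + 1 := ⟨n - 1, by omega⟩
  have hk : (29 : ℝ) ≤ k := by exact_mod_cast (by omega : 29 ≤ k)
  rw [Nat.add_sub_cancel, Nat.cast_choose_two]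
  push_cast
  nlinarith

/-- The exponential is at most `exp (-15 * n)`, while `4 ^ n * n ^ 2 ≤ exp (4 * n)`. -/
lemma coarse_bound {P q : ℝ} (hq : 10 ^ 8 ≤ q) (hP : 0.45 * q ≤ P) (hn : 0 < n) :
    4 ^ n * Real.exp (-(P / 3 * (n / 10 ^ 6))) ≤ 1 / (n : ℝ) ^ 2 := by
  have hn' : (0 : ℝ) < n := by exact_mod_cast hn
  have h4 : (4 : ℝ) ≤ Real.exp 2 := by
    have h := Real.exp_one_gt_d9
    have h2 : Real.exp 2 = Real.exp 1 * Real.exp 1 := by rw [← Real.exp_add]; norm_num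
    rw [h2]
    nlinarith
  have h4n : (4 : ℝ) ^ n ≤ Real.exp (n * 2) := by
    rw [Real.exp_nat_mul]
    exact pow_le_pow_left₀ (by norm_num) h4 n
  have hn2 : (n : ℝ) ^ 2 ≤ Real.exp (n * 2) := by
    refine (pow_le_pow_left₀ hn'.le (nat_cast_le_exp n) 2).trans (le_of_eq ?_)
    rw [← Real.exp_nat_mul, mul_comm, Nat.cast_two]
  rw [le_div_iff₀ (by positivity)]
  calc 4 ^ n * Real.exp (-(P / 3 * (n / 10 ^ 6))) * (n : ℝ) ^ 2
      ≤ Real.exp (n * 2) * Real.exp (-(P / 3 * (n / 10 ^ 6))) * Real.exp (n * 2) := by gcongr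
    _ = Real.exp (n * 2 + -(P / 3 * (n / 10 ^ 6)) + n * 2) := by rw [Real.exp_add, Real.exp_add]
    _ ≤ 1 := by
        rw [Real.exp_le_one_iff]
        have : 0 ≤ (P - 45000000) * n := mul_nonneg (by linarith) hn'.le
        linarith

lemma ten_le_exp_three : (10 : ℝ) ≤ Real.exp 3 := by
  have h := Real.exp_one_gt_d9
  have h2 : Real.exp 3 = Real.exp 1 ^ 3 := by rw [← Real.exp_nat_mul]; norm_num
  rw [h2]
  exact le_trans (by norm_num) (pow_le_pow_left₀ (by norm_num) h.le 3)

/-- Every factor is compared with `exp (k * _)`: the lower bound on `k` gives `n / k ≤ 10 * exp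
(0.01 * q)`, so even the number of solutions is at most `exp k`. The gain `exp (-0.125 * q * k)`
comes from `2 * t ≤ q / 10` and `P / 2 ≥ 0.225 * q`. -/
lemma low_bound {P q : ℝ} (hq : 10 ^ 8 ≤ q) (hP : 0.45 * q ≤ P) (hn : 0 < n) {t k : ℕ}
    (ht : (t : ℝ) ≤ q / 20) (hk : 0 < k) (hkn : Real.exp (-(0.01 * q)) * n / 10 ≤ k) :
    (1 + Real.exp (-(P / 3))) ^ n
      * (n.choose k * (4 ^ t * Real.exp (-(P / 2))) ^ k) ≤ 1 / (n : ℝ) ^ 2 := by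
  have hn' : (0 : ℝ) < n := by exact_mod_cast hn
  have hk' : (1 : ℝ) ≤ k := by exact_mod_cast hk
  have hk0 : (0 : ℝ) < k := by linarith
  have hnk : (n : ℝ) / k ≤ Real.exp (3 + 0.01 * q) := by
    rw [div_le_iff₀ hk0, Real.exp_add]
    have h1 : (n : ℝ) = Real.exp (0.01 * q) * (Real.exp (-(0.01 * q)) * n) := by
      rw [← mul_assoc, ← Real.exp_add]; simp
    have h2 : Real.exp (-(0.01 * q)) * n ≤ 10 * k := by linarith
    calc (n : ℝ) = Real.exp (0.01 * q) * (Real.exp (-(0.01 * q)) * n) := h1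
      _ ≤ Real.exp (0.01 * q) * (10 * k) := by gcongr
      _ ≤ Real.exp (0.01 * q) * (Real.exp 3 * k) := by
          have := ten_le_exp_three
          gcongr
      _ = Real.exp 3 * Real.exp (0.01 * q) * k := by ring
  have hnk' : (n : ℝ) ≤ Real.exp (3 + 0.01 * q) * k := by rwa [div_le_iff₀ hk0] at hnk
  have h4 : (4 : ℝ) ≤ Real.exp 2 := by
    have h := Real.exp_one_gt_d9
    have h2 : Real.exp 2 = Real.exp 1 * Real.exp 1 := by rw [← Real.exp_add]; norm_num
    rw [h2]
    nlinarith
  have hm : (1 + Real.exp (-(P / 3))) ^ n ≤ Real.exp k := by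
    have h1 : 1 + Real.exp (-(P / 3)) ≤ Real.exp (Real.exp (-(P / 3))) := by
      have := Real.add_one_le_exp (Real.exp (-(P / 3)))
      linarith
    refine (pow_le_pow_left₀ (by positivity) h1 n).trans ?_
    rw [← Real.exp_nat_mul, Real.exp_le_exp]
    calc (n : ℝ) * Real.exp (-(P / 3))
        ≤ Real.exp (3 + 0.01 * q) * k * Real.exp (-(P / 3)) := by gcongr
      _ = Real.exp (3 + 0.01 * q + -(P / 3)) * k := by rw [Real.exp_add _ (-(P / 3))]; ring
      _ ≤ 1 * k := by
          gcongr
          rw [Real.exp_le_one_iff]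
          linarith
      _ = k := one_mul _
  have hc : (n.choose k : ℝ) ≤ Real.exp (k * (4 + 0.01 * q)) := by
    refine (choose_le_exp_mul_pow n hk).trans ?_
    rw [Real.exp_nat_mul]
    refine pow_le_pow_left₀ (by positivity) ?_ k
    calc Real.exp 1 * (n / k) ≤ Real.exp 1 * Real.exp (3 + 0.01 * q) := by gcongr
      _ = Real.exp (4 + 0.01 * q) := by rw [← Real.exp_add]; congr 1; ring
  have hx : (4 ^ t * Real.exp (-(P / 2))) ^ k ≤ Real.exp (k * (-(0.125 * q))) := by
    rw [Real.exp_nat_mul]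
    refine pow_le_pow_left₀ (by positivity) ?_ k
    calc (4 : ℝ) ^ t * Real.exp (-(P / 2)) ≤ Real.exp 2 ^ t * Real.exp (-(P / 2)) := by gcongr
      _ = Real.exp (t * 2 + -(P / 2)) := by rw [Real.exp_add, Real.exp_nat_mul]
      _ ≤ Real.exp (-(0.125 * q)) := Real.exp_le_exp.2 (by linarith)
  have hn2 : (n : ℝ) ^ 2 ≤ Real.exp (k * (8 + 0.02 * q)) := by
    have h1 : (n : ℝ) ≤ Real.exp (k * (4 + 0.01 * q)) := by
      refine hnk'.trans ?_
      calc Real.exp (3 + 0.01 * q) * k ≤ Real.exp (3 + 0.01 * q) * Real.exp k := by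
            have := nat_cast_le_exp k
            gcongr
        _ = Real.exp (3 + 0.01 * q + k) := by rw [← Real.exp_add]
        _ ≤ Real.exp (k * (4 + 0.01 * q)) := by
            refine Real.exp_le_exp.2 ?_
            have : 0 ≤ ((k : ℝ) - 1) * (3 + 0.01 * q) :=
              mul_nonneg (by linarith) (by linarith)
            linarith
    calc (n : ℝ) ^ 2 ≤ Real.exp (k * (4 + 0.01 * q)) ^ 2 := by gcongr
      _ = Real.exp (k * (8 + 0.02 * q)) := by
          rw [← Real.exp_nat_mul]; congr 1; push_cast; ring
  rw [le_div_iff₀ (by positivity)]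
  calc (1 + Real.exp (-(P / 3))) ^ n * (n.choose k * (4 ^ t * Real.exp (-(P / 2))) ^ k)
        * (n : ℝ) ^ 2
      ≤ Real.exp k * (Real.exp (k * (4 + 0.01 * q)) * Real.exp (k * (-(0.125 * q))))
        * Real.exp (k * (8 + 0.02 * q)) := by gcongr
    _ = Real.exp (k * (13 - 0.095 * q)) := by
        rw [← Real.exp_add, ← Real.exp_add, ← Real.exp_add]
        congr 1
        ring
    _ ≤ 1 := by
        rw [Real.exp_le_one_iff]
        exact mul_nonpos_of_nonneg_of_nonpos hk0.le (by linarith)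

lemma proportional_term_bound {q ρ : ℝ} (hq : 10 ^ 8 ≤ q) (hρ : q / 400 ≤ ρ) (hn : 0 < n) {u : ℕ}
    (hu : 0 < u) (hun : (u : ℝ) ≤ n / 10 ^ 6) :
    n.choose u * ((10 ^ 4 * u / n : ℝ) ^ (ρ * u) * Real.exp (8 * u * q / 10 ^ 4))
      ≤ 1 / (n : ℝ) ^ 3 := by
  have hn' : (0 : ℝ) < n := by exact_mod_cast hn
  have hu1 : (1 : ℝ) ≤ u := by exact_mod_cast hu
  have hu0 : (0 : ℝ) < u := by linarith
  set y : ℝ := 10 ^ 4 * u / n with hy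
  have hy0 : 0 < y := by positivity
  have hylt : y ≤ 1 / 100 := by
    rw [hy, div_le_iff₀ hn']
    linarith
  -- In terms of `l ≥ 4` the entropy cost per variable is `O(l)` and the gain is at least `l * q /
  -- 400`, which also outweighs `8 * q / 10 ^ 4`.
  obtain ⟨l, hl⟩ : ∃ l, l = -Real.log y := ⟨_, rfl⟩
  have hyl : y = Real.exp (-l) := by rw [hl, neg_neg, Real.exp_log hy0]
  have e10 : (10 : ℝ) ^ 4 ≤ Real.exp 10 := by
    have h2 : Real.exp 10 = Real.exp 1 ^ 10 := by rw [← Real.exp_nat_mul]; norm_num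
    rw [h2]
    exact le_trans (by norm_num) (pow_le_pow_left₀ (by norm_num) Real.exp_one_gt_d9.le 10)
  have hl4 : 4 ≤ l := by
    have h1 : Real.exp 4 ≤ 100 := by
      have h2 : Real.exp 4 = Real.exp 1 ^ 4 := by rw [← Real.exp_nat_mul]; norm_num
      rw [h2]
      exact (pow_le_pow_left₀ (Real.exp_pos _).le Real.exp_one_lt_d9.le 4).trans (by norm_num)
    have h3 : y ≤ Real.exp (-4) := by
      rw [Real.exp_neg]
      refine hylt.trans ?_
      rw [one_div]
      exact inv_anti₀ (Real.exp_pos _) h1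
    rw [hyl, Real.exp_le_exp] at h3
    linarith
  have hnu : (n : ℝ) / u ≤ Real.exp (10 + l) := by
    have h1 : (n : ℝ) / u = 10 ^ 4 * y⁻¹ := by
      rw [hy]; field_simp
    rw [h1, hyl, ← Real.exp_neg, neg_neg, Real.exp_add]
    gcongr
  have hc : (n.choose u : ℝ) ≤ Real.exp (u * (11 + l)) := by
    refine (choose_le_exp_mul_pow n hu).trans ?_
    rw [Real.exp_nat_mul]
    refine pow_le_pow_left₀ (by positivity) ?_ u
    calc Real.exp 1 * (n / u) ≤ Real.exp 1 * Real.exp (10 + l) := by gcongr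
      _ = Real.exp (11 + l) := by rw [← Real.exp_add]; congr 1; ring
  have hyp : y ^ (ρ * u) ≤ Real.exp (u * (-(l * q / 400))) := by
    rw [hyl, ← Real.exp_mul, Real.exp_le_exp]
    have h1 : 0 ≤ (ρ - q / 400) * (u * l) :=
      mul_nonneg (by linarith) (mul_nonneg hu0.le (by linarith))
    linarith
  have hn3 : (n : ℝ) ^ 3 ≤ Real.exp (u * (33 + 3 * l)) := by
    have h1 : (n : ℝ) ≤ Real.exp (u * (11 + l)) := by
      rw [div_le_iff₀ hu0] at hnu
      refine hnu.trans ?_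
      calc Real.exp (10 + l) * u ≤ Real.exp (10 + l) * Real.exp u := by
            have := nat_cast_le_exp u
            gcongr
        _ = Real.exp (10 + l + u) := by rw [← Real.exp_add]
        _ ≤ Real.exp (u * (11 + l)) := by
            refine Real.exp_le_exp.2 ?_
            have : 0 ≤ ((u : ℝ) - 1) * (10 + l) := mul_nonneg (by linarith) (by linarith)
            linarith
    calc (n : ℝ) ^ 3 ≤ Real.exp (u * (11 + l)) ^ 3 := by gcongr
      _ = Real.exp (u * (33 + 3 * l)) := by
          rw [← Real.exp_nat_mul]; congr 1; push_cast; ring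
  rw [le_div_iff₀ (by positivity)]
  calc n.choose u * (y ^ (ρ * u) * Real.exp (8 * u * q / 10 ^ 4)) * (n : ℝ) ^ 3
      ≤ Real.exp (u * (11 + l)) * (Real.exp (u * (-(l * q / 400)))
        * Real.exp (8 * u * q / 10 ^ 4)) * Real.exp (u * (33 + 3 * l)) := by gcongr
    _ = Real.exp (u * (44 + 4 * l + 8 * q / 10 ^ 4 - l * q / 400)) := by
        rw [← Real.exp_add, ← Real.exp_add, ← Real.exp_add]
        congr 1
        ring
    _ ≤ 1 := by
        rw [Real.exp_le_one_iff]
        refine mul_nonpos_of_nonneg_of_nonpos hu0.le ?_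
        have h1 : 0 ≤ (l - 4) * (q - 10 ^ 8) := mul_nonneg (by linarith) (by linarith)
        nlinarith

lemma proportional_bound {q ρ : ℝ} (hq : 10 ^ 8 ≤ q) (hρ : q / 400 ≤ ρ) (hn : 0 < n) :
    ∑ u ∈ (Finset.range (n + 1)).filter (fun u : ℕ => 0 < u ∧ (u : ℝ) ≤ n / 10 ^ 6),
        n.choose u * ((10 ^ 4 * u / n : ℝ) ^ (ρ * u) * Real.exp (8 * u * q / 10 ^ 4))
      ≤ 1 / (n : ℝ) ^ 2 := by
  have hn' : (0 : ℝ) < n := by exact_mod_cast hn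
  have hcard : ((Finset.range (n + 1)).filter
      (fun u : ℕ => 0 < u ∧ (u : ℝ) ≤ n / 10 ^ 6)).card ≤ n := by
    have hsub : (Finset.range (n + 1)).filter (fun u : ℕ => 0 < u ∧ (u : ℝ) ≤ n / 10 ^ 6)
        ⊆ Finset.Icc 1 n := by
      intro u hu
      obtain ⟨h1, h2, -⟩ := Finset.mem_filter.1 hu
      exact Finset.mem_Icc.2 ⟨h2, Nat.lt_succ_iff.1 (Finset.mem_range.1 h1)⟩
    simpa using Finset.card_le_card hsub
  refine (Finset.sum_le_card_nsmul _ _ (1 / (n : ℝ) ^ 3) fun u hu => ?_).trans ?_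
  · obtain ⟨-, h2, h3⟩ := Finset.mem_filter.1 hu
    exact proportional_term_bound hq hρ hn h2 h3
  · rw [nsmul_eq_mul]
    calc _ ≤ (n : ℝ) * (1 / (n : ℝ) ^ 3) := by gcongr
      _ = 1 / (n : ℝ) ^ 2 := by field_simp

/-! ### The failure probability -/

open Classical in
lemma probSat_le {p ε : ℝ} {A : Formula n → Prop}
    (h : ∀ σ : ClauseOrder n, expect p (fun S => if A (process σ S) then 1 else 0) ≤ ε) :
    probSat n p A ≤ ε := by
  have : Nonempty (ClauseOrder n) := ⟨(Fintype.equivFin _).symm⟩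
  have hpos : (0 : ℝ) < Fintype.card (ClauseOrder n) := by exact_mod_cast Fintype.card_pos
  rw [probSat, div_le_iff₀ hpos, mul_comm, ← nsmul_eq_mul]
  refine Finset.sum_le_card_nsmul _ _ _ fun σ _ => ?_
  simpa [expect] using h σ

lemma probSat_nonneg {p : ℝ} (h0 : 0 ≤ p) (h1 : p ≤ 1) (A : Formula n → Prop) :
    0 ≤ probSat n p A := by
  refine div_nonneg (Finset.sum_nonneg fun σ _ => Finset.sum_nonneg fun S _ => ?_)
    (Nat.cast_nonneg _)
  split_ifs
  · exact coinProb_nonneg h0 h1 S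
  · exact le_rfl

/-- The expansion parameter of the core. -/
noncomputable def coreParam (n : ℕ) (p : ℝ) : ℕ := ⌊(n : ℝ) ^ 2 * p / 40⌋₊ + 1

theorem probSat_not_hasLargeFrozenCore_le {p : ℝ} (h0 : 0 ≤ p) (h1 : p ≤ 1) (hn : 30 ≤ n)
    (hq : 10 ^ 8 ≤ (n : ℝ) ^ 2 * p) :
    probSat n p (fun F => ¬ HasLargeFrozenCore F (coreParam n p)
      ((1 - Real.exp (-(0.01 * ((n : ℝ) ^ 2 * p)))) * n)) ≤ 3 / (n : ℝ) ^ 2 := by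
  classical
  have hn0 : 0 < n := by omega
  have hn' : (0 : ℝ) < n := by exact_mod_cast hn0
  obtain ⟨q, hqdef⟩ : ∃ q, q = (n : ℝ) ^ 2 * p := ⟨_, rfl⟩
  obtain ⟨t, htdef⟩ : ∃ t, t = coreParam n p := ⟨_, rfl⟩
  obtain ⟨P, hPdef⟩ : ∃ P, P = p * ((n - 1).choose 2 : ℕ) := ⟨_, rfl⟩
  rw [← hqdef] at hq ⊢
  rw [← htdef]
  have hP : 0.45 * q ≤ P := by
    have := mul_le_mul_of_nonneg_left (le_choose_two hn) h0
    rw [hPdef, hqdef]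
    linarith
  have ht : (t : ℝ) = ⌊q / 40⌋₊ + 1 := by rw [htdef, coreParam, hqdef]; push_cast; rfl
  have ht1 : q / 40 ≤ t := by rw [ht]; exact (Nat.lt_floor_add_one _).le
  -- Hence the support threshold `2 * t` is at most `q / 10`, well below the planted mean, which is
  -- at least `P ≥ 0.45 * q`.
  have ht2 : (t : ℝ) ≤ q / 20 := by
    have := Nat.floor_le (a := q / 40) (by linarith)
    rw [ht]
    linarith
  have ht0 : (0 : ℝ) < t := by linarith
  -- Fewer than `k` low-support variables means that ten times their number is at most `exp (-0.01 *
  -- q) * n`, the permitted loss.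
  set k := ⌊Real.exp (-(0.01 * q)) * n / 10⌋₊ + 1 with hk
  have hkn : Real.exp (-(0.01 * q)) * n / 10 ≤ k := by
    rw [hk]; push_cast; exact (Nat.lt_floor_add_one _).le
  -- The bound `exp z ≥ 1 + z` suffices because `0.01 * q ≥ 10 ^ 6`.
  have hexp : Real.exp (-(0.01 * q)) ≤ 1 / 10 ^ 6 := by
    rw [Real.exp_neg, ← one_div]
    refine one_div_le_one_div_of_le (by norm_num) ?_
    have := Real.add_one_le_exp (0.01 * q)
    linarith
  refine probSat_le fun σ => ?_
  have hind : ∀ S : Formula n,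
      (if ¬ HasLargeFrozenCore (process σ S) t ((1 - Real.exp (-(0.01 * q))) * n)
        then (1 : ℝ) else 0)
      ≤ ((if ¬ IsProportional S ((t : ℝ) / 10) then 1 else 0)
        + (if ∃ ψ ψ' : Assignment n, (n : ℝ) / 10 ^ 6 < diff ψ ψ' ∧
          Satisfies ψ' (S ∩ satClauses ψ) then 1 else 0))
        + (if ∃ ψ, Satisfies ψ (process σ S) ∧
          k ≤ (lowSupport (process σ S) ψ (2 * t)).card then 1 else 0) := by
    intro S
    by_cases hA : IsProportional S ((t : ℝ) / 10)
    swap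
    · rw [if_pos hA]
      split_ifs <;> norm_num
    by_cases hB : ∃ ψ ψ' : Assignment n, (n : ℝ) / 10 ^ 6 < diff ψ ψ' ∧
        Satisfies ψ' (S ∩ satClauses ψ)
    · rw [if_pos hB]
      split_ifs <;> norm_num
    by_cases hC : ∃ ψ, Satisfies ψ (process σ S) ∧
        k ≤ (lowSupport (process σ S) ψ (2 * t)).card
    · rw [if_pos hC]
      split_ifs <;> norm_num
    have hgood : HasLargeFrozenCore (process σ S) t ((1 - Real.exp (-(0.01 * q))) * n) := by
      obtain ⟨ψ, hψ⟩ := satisfiable_process σ S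
      push Not at hB hC
      have hlow : 10 * ((lowSupport (process σ S) ψ (2 * t)).card : ℝ)
          ≤ Real.exp (-(0.01 * q)) * n := by
        have h := Nat.lt_succ_iff.1 (hC ψ hψ)
        have h2 := (Nat.le_floor_iff (by positivity)).1 h
        linarith
      have hn6 := mul_le_mul_of_nonneg_right hexp hn'.le
      refine hasLargeFrozenCore_of ht0 hψ (hA.mono (process_subset σ S)) (by linarith)
        (by linarith) fun ψ' hψ' => ?_
      by_contra! hlt
      refine hB ψ ψ' hlt ?_
      rwa [← process_eq_inter hψ]
    rw [if_neg (not_not.2 hgood), if_neg (not_not.2 hA), if_neg hB, if_neg hC]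
    norm_num
  refine le_trans (le_of_eq (by congr!)) ((expect_mono h0 h1 hind).trans ?_)
  rw [expect_add, expect_add]
  have b1 := expect_not_isProportional_le (n := n) h0 h1 ((t : ℝ) / 10)
  have b2 := expect_exists_diff_le (n := n) h0 h1 ((n : ℝ) / 10 ^ 6)
  have b3 := expect_lowSupport_le (n := n) h0 h1 (by positivity)
    (fun ψ => expect_numSat_le h0 h1 ψ) σ t k
  rw [← hqdef] at b1
  rw [← hPdef] at b2 b3
  replace b1 := b1.trans (proportional_bound hq (by linarith) hn0)
  replace b2 := b2.trans (coarse_bound hq hP hn0)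
  replace b3 := b3.trans (low_bound hq hP hn0 ht2 (Nat.succ_pos _) hkn)
  have e3 : 3 / (n : ℝ) ^ 2 = 1 / (n : ℝ) ^ 2 + 1 / (n : ℝ) ^ 2 + 1 / (n : ℝ) ^ 2 := by ring
  rw [e3]
  refine add_le_add (add_le_add (le_trans (le_of_eq ?_) b1) b2) b3
  congr!

/-- The claim amounts to `√m ≤ ε * n ^ 2 / 3`, which follows from `2 * n ^ 3 ≤ ε ^ 2 * n ^ 4 / 9`;
hence the threshold `18 / ε ^ 2`. -/
lemma three_div_sq_le {m ε : ℝ} (hε : 0 < ε) (hm : 0 < m) (hmn : m ≤ 2 * (n : ℝ) ^ 3)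
    (hn : 18 / ε ^ 2 ≤ n) (hn0 : 0 < n) : 3 / (n : ℝ) ^ 2 ≤ ε * m ^ (-(1 / 2) : ℝ) := by
  have hn' : (0 : ℝ) < n := by exact_mod_cast hn0
  rw [Real.rpow_neg hm.le, ← Real.sqrt_eq_rpow, ← div_eq_mul_inv,
    div_le_div_iff₀ (by positivity) (Real.sqrt_pos.2 hm)]
  have h1 : Real.sqrt m ≤ ε * (n : ℝ) ^ 2 / 3 := by
    refine Real.sqrt_le_iff.2 ⟨by positivity, hmn.trans ?_⟩
    rw [div_le_iff₀ (by positivity)] at hn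
    have := mul_le_mul_of_nonneg_right hn (by positivity : 0 ≤ (n : ℝ) ^ 3)
    nlinarith
  linarith

end RandomSat

theorem mainTheorem7 :
    ∃ (d c : ℝ) (t : ℕ → ℝ → ℕ), 0 < d ∧ 0 < c ∧ (∀ n p, 0 < t n p) ∧
      ∀ p : ℕ → ℝ, (∀ n, 0 ≤ p n ∧ p n ≤ 1) →
        (∀ᶠ n : ℕ in Filter.atTop, d ≤ (n : ℝ) ^ 2 * p n) →
        RandomSat.Whp p fun n F =>
          RandomSat.HasLargeFrozenCore F (t n (p n))
            ((1 - Real.exp (-(c * ((n : ℝ) ^ 2 * p n)))) * n) := by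
  refine ⟨10 ^ 8, 0.01, RandomSat.coreParam, by norm_num, by norm_num,
    fun n p => Nat.succ_pos _, fun p hp hd => ?_⟩
  refine Asymptotics.isLittleO_iff.2 fun ε hε => ?_
  filter_upwards [hd, Filter.eventually_ge_atTop 30,
    Filter.eventually_ge_atTop ⌈18 / ε ^ 2⌉₊] with n hq hn hnε
  obtain ⟨h0, h1⟩ := hp n
  have hn' : (0 : ℝ) < n := by exact_mod_cast (by omega : 0 < n)
  have hp0 : 0 < p n := by
    rcases h0.eq_or_lt with h | h
    · rw [← h, mul_zero] at hq
      norm_num at hq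
    · exact h
  have hc0 : (0 : ℝ) < n.choose 3 := by exact_mod_cast Nat.choose_pos (by omega : 3 ≤ n)
  have hc : (n.choose 3 : ℝ) ≤ (n : ℝ) ^ 3 / 6 := by
    have := Nat.choose_le_pow_div (α := ℝ) 3 n
    simpa [Nat.factorial] using this
  have hm : 0 < 8 * (n.choose 3 : ℝ) * p n := by positivity
  rw [Real.norm_of_nonneg (RandomSat.probSat_nonneg h0 h1 _),
    Real.norm_of_nonneg (Real.rpow_nonneg hm.le _)]
  refine (RandomSat.probSat_not_hasLargeFrozenCore_le h0 h1 hn hq).trans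
    (RandomSat.three_div_sq_le hε hm ?_ (Nat.ceil_le.1 hnε) (by omega))
  have h2 : 8 * (n.choose 3 : ℝ) * p n ≤ 8 * (n.choose 3 : ℝ) * 1 := by gcongr
  have h3 : 0 < (n : ℝ) ^ 3 := by positivity
  linarith
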